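/- Let $\mathcal X,\mathcal Y$ be finite sets, $P_{X,Y}$ a probability distribution on $\mathcal X\times\mathcal Y$, and let $|\psi\rangle\in\mathcal H_A\otimes\mathcal H_B=\mathbb C^{\mathcal X}\otimes\mathbb C^{\mathcal Y}$ be a regular embedding of $P_{X,Y}$, i.e. $|\langle x,y|\psi\rangle|^2=P_{X,Y}(x,y)$ for all $x,y$. Write $|\psi\rangle=\sum_x\sqrt{P_X(x)}\,|x\rangle|\psi_x\rangle$. Let $X\searrow Y:=P_{Y|X=X}$ be the dependent part of $X$ with respect to $Y$ (the random variable $x\mapsto P_{Y|X=x}$ evaluated at Alice's outcome $X$), and similarly $Y\searrow X$. The embedding is *trivial* if $S(X\searrow Y\,|\,B)=0$ or $S(Y\searrow X\,|\,A)=0$, where $S(K|B)=S(KB)-S(B)$ is the conditional von Neumann entropy of a classical variable $K$, computed from the other party's measurement outcome in the computational basis, given the quantum register. An *ideal functionality* assigns to every input in $[0,1]$ of either party a measurement (quantum instrument with finitely many outcomes, encoded in $[0,1]$) of that party's register of $|\psi\rangle$, input $0$ being the measurement in the computational basis; it returns the classical outcome and keeps the residual state. The state $|\psi\rangle$ is *weakly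 self-composable* if there is an ideal functionality such that for each choice of the adversary (Alice or Bob), every $m>0$ and every attack (a POVM with finitely many outcomes on all $m$ registers of the adversary in $|\psi\rangle^{\otimes m}$) there is a classical randomized simulator which, by (adaptive, possibly repeated, finitely many) queries to $m$ independent copies of the functionality, produces an output having the same joint distribution with the honest party's $m$ computational-basis outcomes as the outcome of the attack. Challenge with parameters $x_0,x_1\in\mathcal X$, $c>0$, $m$: Alice measures her $m$ registers of $|\psi\rangle^{\otimes m}$ in the computational basis and gets $X_1,\dots,X_m$. If $x_0$ or $x_1$ occurs fewer than two times, the payoff is $0$. Otherwise she draws $(\alpha,\beta)\in\{x_0,x_1\}^2$ uniformly, then an ordered pair of positions $h\neq h'$ uniformly among those with $(X_h,X_{h'})=(\alpha,\beta)$, and announces $(h,h')$. Bob answers "equal", "different" or "don't know"; the payoff is $1$ if he answers correctly whether $\alpha=\beta$, $-c$ if he answers incorrectly, and $0$ if he answers "don't know". Theorem. (i) If $|\psi\rangle$ is weakly self-composable, then it is a trivial embedding of $P_{X,Y}$. (ii) If $|\psi\rangle$ is non-trivial, then there are $x_0,x_1\in\mathcal X$ with $P_X(x_0),P_X(x_1)>0$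 and $0<|\langle\psi_{x_0}|\psi_{x_1}\rangle|<1$, and there are $c>0$, $\varepsilon>0$ and $M$ such that for every $m\ge M$ there is a coherent strategy of Bob in the challenge (for each announcement $(h,h')$ a POVM on his $m$ registers) whose expected payoff exceeds by at least $\varepsilon$ the expected payoff of every strategy that, after the announcement, only uses classical randomness and queries to $m$ independent copies of an ideal functionality, whatever that ideal functionality is. -/

import Mathlib

open scoped Kronecker Matrix ComplexOrder

noncomputable section

namespace Composability

/-! ### Entropies, embeddings, triviality -/

/-- Von Neumann entropy of a Hermitian matrix: the Shannon entropy (natural logarithm) of its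
eigenvalues. -/
def vonNeumannEntropy {n : Type*} [Fintype n] [DecidableEq n] {A : Matrix n n ℂ}
    (hA : A.IsHermitian) : ℝ :=
  ∑ i, Real.negMulLog (hA.eigenvalues i)

section Embedding

variable {X Y : Type*} [Fintype X] [Fintype Y]

/-- The conditional distribution `P_{Y|X=x}`. The dependent part of `X` with respect to `Y` is the
random variable `condDist P X`. -/
def condDist (P : X × Y → ℝ) (x : X) : Y → ℝ :=
  fun y => P (x, y) / ∑ y', P (x, y')

/-- Exchange the roles of Alice and Bob in a joint distribution. -/
def swapDist (P : X × Y → ℝ) : Y × X → ℝ := fun p => P p.swap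

/-- Exchange the roles of Alice and Bob in a bipartite pure state. -/
def swapState (ψ : EuclideanSpace ℂ (X × Y)) : EuclideanSpace ℂ (Y × X) :=
  WithLp.toLp 2 fun p => ψ p.swap

/-- A pure state of the registers `A`, `B` (computational bases `X`, `Y`, no auxiliary registers) is
a regular embedding of `P` if measuring both registers in the computational basis has law `P`,
i.e. `ψ = ∑ exp(iθ(x,y)) √P(x,y) |x,y⟩`. Since the auxiliary registers are trivial, the correctness
condition `S(X;YB') = S(XA';Y) = I(X;Y)` holds by itself. -/
def IsRegularEmbedding (P : X × Y → ℝ) (ψ : EuclideanSpace ℂ (X × Y)) : Prop :=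
  ∀ p, ‖ψ p‖ ^ 2 = P p

/-- Bob's normalized state `|ψ_x⟩` after Alice has obtained `x`, so that
`ψ = ∑ x, √P_X(x) |x⟩ ⊗ |ψ_x⟩`. -/
def condState (P : X × Y → ℝ) (ψ : EuclideanSpace ℂ (X × Y)) (x : X) : EuclideanSpace ℂ Y :=
  WithLp.toLp 2 fun y => ((√(∑ y', P (x, y')) : ℝ) : ℂ)⁻¹ * ψ (x, y)

/-- Reduced density matrix of the second register. -/
def reducedState {X Y : Type*} [Fintype X] (ψ : EuclideanSpace ℂ (X × Y)) : Matrix Y Y ℂ :=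
  fun y y' => ∑ x, ψ (x, y) * star (ψ (x, y'))

open Classical in
/-- Joint state of the classical variable `condDist P X` (the dependent part of `X` with respect to
`Y`, where `X` is the outcome of measuring the first register in the computational basis) and of the
second register: `∑ d, |d⟩⟨d| ⊗ ∑ (x with P_{Y|X=x} = d), P_X(x) |ψ_x⟩⟨ψ_x|`. -/
def depState (P : X × Y → ℝ) (ψ : EuclideanSpace ℂ (X × Y)) :
    Matrix (Set.range (condDist P) × Y) (Set.range (condDist P) × Y) ℂ :=
  fun a b => if a.1 = b.1 then
    ∑ x, if condDist P x = a.1 then ψ (x, a.2) * star (ψ (x, b.2)) else 0 else 0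

theorem reducedState_isHermitian {X Y : Type*} [Fintype X] (ψ : EuclideanSpace ℂ (X × Y)) :
    (reducedState ψ).IsHermitian := by
  ext y y'
  simp [reducedState, Matrix.conjTranspose_apply, mul_comm]

theorem depState_isHermitian (P : X × Y → ℝ) (ψ : EuclideanSpace ℂ (X × Y)) :
    (depState P ψ).IsHermitian := by
  ext ⟨d, y⟩ ⟨d', y'⟩
  by_cases h : d = d'
  · subst h
    simp only [depState, Matrix.conjTranspose_apply, if_true, star_sum]
    refine Finset.sum_congr rfl fun x _ => ?_
    split_ifs <;> simp [mul_comm]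
  · simp [depState, Matrix.conjTranspose_apply, h, Ne.symm h]

open Classical in
/-- `S(X↘Y | B) = S((X↘Y) B) - S(B)`. -/
def depEntropy (P : X × Y → ℝ) (ψ : EuclideanSpace ℂ (X × Y)) : ℝ :=
  vonNeumannEntropy (depState_isHermitian P ψ) - vonNeumannEntropy (reducedState_isHermitian ψ)

/-- Trivial embedding: `S(Y↘X | A) = 0` or `S(X↘Y | B) = 0`. -/
def IsTrivial (P : X × Y → ℝ) (ψ : EuclideanSpace ℂ (X × Y)) : Prop :=
  depEntropy (swapDist P) (swapState ψ) = 0 ∨ depEntropy P ψ = 0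

end Embedding

/-! ### Attacks on several copies -/

/-- A POVM with outcomes in `O` on the register with computational basis `S`. -/
structure POVM (S O : Type*) [Fintype S] [DecidableEq S] [Fintype O] where
  elem : O → Matrix S S ℂ
  posSemidef : ∀ o, (elem o).PosSemidef
  sum_eq_one : ∑ o, elem o = 1

section Attack

/- `H` is the (computational basis of the) register of the honest party, `D` that of the dishonest
party. -/
variable {H D O : Type*} [Fintype H] [Fintype D] [DecidableEq H] [DecidableEq D] [Fintype O] {m : ℕ}

/-- The unnormalized state `(⟨x| ⊗ 1) |ψ⟩^{⊗m}` of the dishonest party's `m` registers when the honest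
party gets `x = (x_1, …, x_m)`. -/
def residualVector (ψ : EuclideanSpace ℂ (H × D)) (x : Fin m → H) : (Fin m → D) → ℂ :=
  fun y => ∏ i, ψ (x i, y i)

/-- Real world: the probability that, on `|ψ⟩^{⊗m}`, the honest party measures `x` in the
computational basis and the attack, a POVM on all `m` registers of the dishonest party jointly,
gives `o`. -/
def attackProb (ψ : EuclideanSpace ℂ (H × D)) (E : POVM (Fin m → D) O) (x : Fin m → H) (o : O) : ℝ :=
  (star (residualVector ψ x) ⬝ᵥ (E.elem o *ᵥ residualVector ψ x)).re

end Attack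

/-! ### Ideal functionalities and simulation -/

/-- A measurement with finitely many classical outcomes, encoded in `[0,1]`, together with the
residual state: outcome `w` maps `σ` to `∑ k, K_{w,k} σ K_{w,k}ᴴ` (unnormalized). -/
structure Instrument (S : Type*) [Fintype S] [DecidableEq S] where
  outcomes : Finset unitInterval
  rank : ℕ
  kraus : unitInterval → Fin rank → Matrix S S ℂ
  complete : ∑ w ∈ outcomes, ∑ k, (kraus w k)ᴴ * kraus w k = 1

/-- The measurement in the computational basis, with outcome `s` encoded as `enc s`. -/
def Instrument.computational {S : Type*} [Fintype S] [DecidableEq S] (enc : S ↪ unitInterval) :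
    Instrument S where
  outcomes := Finset.univ.map enc
  rank := 1
  kraus w _ := Matrix.diagonal fun s => if enc s = w then 1 else 0
  complete := by
    ext s t
    simp only [Matrix.diagonal_conjTranspose, Matrix.diagonal_mul_diagonal, Finset.sum_map,
      Matrix.sum_apply]
    by_cases h : s = t
    · subst h; simp
    · simp [h]

/-- An ideal functionality for states of the registers `A`, `B`: each party has inputs in `[0,1]`,
each input specifies a measurement of that party's register, and input `0` is the honest
measurement in the computational basis. Which measurements the other inputs encode is arbitrary. -/
structure IdealFunctionality (X Y : Type*) [Fintype X] [Fintype Y] [DecidableEq X]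
    [DecidableEq Y] where
  encA : X ↪ unitInterval
  encB : Y ↪ unitInterval
  alice : unitInterval → Instrument X
  bob : unitInterval → Instrument Y
  alice_zero : alice 0 = Instrument.computational encA
  bob_zero : bob 0 = Instrument.computational encB

/-- A (classical) simulator with access to one party's interface of `m` independent ideal
functionalities: it may toss biased coins, query adaptively any of the functionalities (any number
of times) and continue according to the outcome, and finally output an element of `O`. -/
inductive Simulator (m : ℕ) (O : Type) : Type
  | output (o : O) : Simulator m O
  | coin (p : unitInterval) (a b : Simulator m O) : Simulator m O
  | query (i : Fin m) (s : unitInterval) (next : unitInterval → Simulator m O) : Simulator m O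

section Simulation

variable {H D : Type*} [Fintype H] [Fintype D] [DecidableEq H] [DecidableEq D] {m : ℕ} {O : Type}

/-- Unnormalized residual state of one functionality after the dishonest party's measurement `M`,
applied to its register only, has given `w`. -/
def Instrument.residual (M : Instrument D) (w : unitInterval) (σ : Matrix (H × D) (H × D) ℂ) :
    Matrix (H × D) (H × D) ℂ :=
  ∑ k, ((1 : Matrix H H ℂ) ⊗ₖ M.kraus w k) * σ * ((1 : Matrix H H ℂ) ⊗ₖ M.kraus w k)ᴴ

/-- The state `|ψ⟩⟨ψ|` in which every functionality starts. -/
def initialState (ψ : EuclideanSpace ℂ (H × D)) : Matrix (H × D) (H × D) ℂ :=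
  fun p q => ψ p * star (ψ q)

open Classical in
/-- Ideal world: `S.prob F σ x o` is the probability that the honest party, measuring in the
computational basis, gets `x_i` from the `i`-th functionality for all `i`, and that the simulator
`S` outputs `o`, where `F` lists the measurements that the dishonest party's inputs stand for and
`σ i` is the current (unnormalized) state of the `i`-th functionality. -/
def Simulator.prob (F : unitInterval → Instrument D) :
    Simulator m O → (Fin m → Matrix (H × D) (H × D) ℂ) → (Fin m → H) → O → ℝ
  | .output o', σ, x, o => if o' = o then ∏ i, (∑ y, σ i (x i, y) (x i, y)).re else 0
  | .coin p a b, σ, x, o => p * a.prob F σ x o + (1 - p) * b.prob F σ x o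
  | .query i s next, σ, x, o =>
      ∑ w ∈ (F s).outcomes, (next w).prob F (Function.update σ i ((F s).residual w (σ i))) x o

/-- The joint law of the honest outcomes and the simulator's output, from `m` functionalities
holding `ψ` each. -/
def simProb (F : unitInterval → Instrument D) (ψ : EuclideanSpace ℂ (H × D)) (S : Simulator m O)
    (x : Fin m → H) (o : O) : ℝ :=
  S.prob F (fun _ => initialState ψ) x o

/-- Every attack of the second party on `ψ^{⊗m}`, for every `m > 0`, is simulated by calls to `m`
functionalities: the joint law of the honest outcomes and of the adversary's output is the same. -/
def SimulatesAttacks (F : unitInterval → Instrument D) (ψ : EuclideanSpace ℂ (H × D)) : Prop :=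
  ∀ (m : ℕ), 0 < m → ∀ (O : Type) [Fintype O] (E : POVM (Fin m → D) O),
    ∃ S : Simulator m O, ∀ x o, simProb F ψ S x o = attackProb ψ E x o

end Simulation

/-- Weak self-composability: some ideal functionality allows one to simulate all attacks, by either
party, on any number of copies. -/
def WeaklySelfComposable {X Y : Type*} [Fintype X] [Fintype Y] [DecidableEq X] [DecidableEq Y]
    (ψ : EuclideanSpace ℂ (X × Y)) : Prop :=
  ∃ I : IdealFunctionality X Y,
    SimulatesAttacks I.bob ψ ∧ SimulatesAttacks I.alice (swapState ψ)

/-! ### The state comparison challenge -/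

section Challenge

variable {X : Type*} [DecidableEq X] {m : ℕ}

/-- The ordered pairs of distinct positions at which Alice's outcomes are `(α, β)`. -/
def pairPositions (x : Fin m → X) (α β : X) : Finset (Fin m × Fin m) :=
  Finset.univ.filter fun h => h.1 ≠ h.2 ∧ x h.1 = α ∧ x h.2 = β

/-- The probability that Alice, having measured `x`, announces the positions `h = (h₁, h₂)`. If `x`
does not contain both `x₀` and `x₁` at least twice, she aborts. Otherwise she draws `(α, β)`
uniformly from `{x₀, x₁}²`, and then `h` uniformly among the pairs of distinct positions with
outcomes `(α, β)`. -/
def announceProb (x₀ x₁ : X) (x : Fin m → X) (h : Fin m × Fin m) : ℝ :=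
  if (pairPositions x x₀ x₀).Nonempty ∧ (pairPositions x x₁ x₁).Nonempty ∧ h.1 ≠ h.2 ∧
      (x h.1 = x₀ ∨ x h.1 = x₁) ∧ (x h.2 = x₀ ∨ x h.2 = x₁) then
    1 / 4 * (1 / ((pairPositions x (x h.1) (x h.2)).card : ℝ))
  else 0

/-- Bob's payoff: `0` for "don't know" (`none`), `1` for a correct answer (`some true` for "equal",
`some false` for "different"), `-c` for a wrong one. -/
def score (c : ℝ) (equal : Bool) : Option Bool → ℝ
  | none => 0
  | some b => if b = equal then 1 else -c

/-- Expected payoff in the challenge (an abort pays `0`), if `R h x b` is the probability that Alice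
measures `x` and that Bob, using his strategy for the announcement `h`, answers `b`. -/
def challengePayoff [Fintype X] (x₀ x₁ : X) (c : ℝ)
    (R : Fin m × Fin m → (Fin m → X) → Option Bool → ℝ) : ℝ :=
  ∑ x : Fin m → X, ∑ h, announceProb x₀ x₁ x h *
    ∑ b, R h x b * score c (decide (x h.1 = x h.2)) b

end Challenge

end Composability

end

noncomputable section

namespace Composability

/-! ### Non-triviality yields two overlapping, non-parallel conditional states -/

section Entropy

/-! It suffices to let Bob be dishonest. Non-triviality gives S(X↘Y|B) ≠ 0, and hence outcomes x₀,
x₁ whose conditional states have overlap of modulus s with 0 < s < 1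
(`exists_overlap_of_depEntropy_ne_zero`). Indeed, if different conditional distributions always came
with orthogonal states, Bob's register would determine the dependent part; and parallel states have
equal distributions.

In the challenge Bob has to compare the states of two registers almost without error. A joint
measurement never errs and answers with probability 1 - s (`exists_comparison_povm`), so its payoff
tends to 1 - s. Register by register, he essentially has to identify each state unambiguously, which
succeeds with probability about (1 - s)².

This second bound must survive adaptive, repeated queries to arbitrary instruments. A query acts on
one register of Bob and preserves Alice's reduced state on average. So a bound by a product of
linear functionals of Alice's reduced states, valid once the queries are over, is valid from the
start (`Simulator.sum_prob_mul_le`). The functional used is the quadratic form at |x₀⟩/√q(x₀) -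
ω|x₁⟩/√q(x₁), initially equal to 2 - 2s. Up to a factor (1 - δ)⁻¹ it dominates the local evidence
for either outcome (`le_quadForm`), and `separable_payoff_le` combines two registers. With penalty
2/δ the payoff is at most ((1 - s)/(1 - δ))² plus an error, which is below 1 - s for δ = s/2.

The announcement law depends on random pair counts; replacing them by their means costs O(1/√m), by
a second moment estimate. Finally (i) follows from (ii): a perfect simulation of the coherent
strategy would earn the same payoff. -/

theorem vonNeumannEntropy_eq_roots {n : Type*} [Fintype n] [DecidableEq n] {A : Matrix n n ℂ}
    (hA : A.IsHermitian) :
    vonNeumannEntropy hA = (A.charpoly.roots.map fun z => Real.negMulLog z.re).sum := by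
  rw [hA.roots_charpoly_eq_eigenvalues, Multiset.map_map]
  simp only [vonNeumannEntropy, Function.comp_apply, Finset.sum_map_val]
  simp

/-- The characteristic polynomials of `L * Lᴴ` and `Lᴴ * L` agree up to powers of `X`; the extra
zero roots contribute nothing because `negMulLog 0 = 0`. -/
theorem sum_roots_X_pow_mul (k : ℕ) {p : Polynomial ℂ} (hp : p ≠ 0) :
    ((Polynomial.X ^ k * p).roots.map fun z : ℂ => Real.negMulLog z.re).sum =
      (p.roots.map fun z => Real.negMulLog z.re).sum := by
  rw [Polynomial.roots_mul (mul_ne_zero (pow_ne_zero _ Polynomial.X_ne_zero) hp),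
    Polynomial.roots_X_pow]
  simp [Multiset.nsmul_singleton]

/-- `L Lᴴ` and `Lᴴ L` have the same entropy. -/
theorem vonNeumannEntropy_mul_conjTranspose {n k : Type*} [Fintype n] [DecidableEq n] [Fintype k]
    [DecidableEq k] {A : Matrix n n ℂ} (hA : A.IsHermitian) (L : Matrix n k ℂ)
    (h : A = L * Lᴴ) :
    vonNeumannEntropy hA =
      vonNeumannEntropy (Matrix.isHermitian_conjTranspose_mul_self L) := by
  subst h
  rw [vonNeumannEntropy_eq_roots, vonNeumannEntropy_eq_roots,
    ← sum_roots_X_pow_mul (Fintype.card k) (Matrix.charpoly_monic _).ne_zero,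
    Matrix.charpoly_mul_comm' L Lᴴ,
    sum_roots_X_pow_mul (Fintype.card n) (Matrix.charpoly_monic _).ne_zero]

theorem vonNeumannEntropy_congr {n : Type*} [Fintype n] [DecidableEq n] {A B : Matrix n n ℂ}
    (hA : A.IsHermitian) (hB : B.IsHermitian) (h : A = B) :
    vonNeumannEntropy hA = vonNeumannEntropy hB := by
  subst h; rfl

variable {X Y : Type*} [Fintype Y]

open Classical in
/-- If outcomes with different conditional distributions leave orthogonal states, then the dependent
part is determined by the second register. -/
theorem depEntropy_eq_zero_of_orthogonal [Fintype X] (P : X × Y → ℝ) (ψ : EuclideanSpace ℂ (X × Y))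
    (h : ∀ x x', condDist P x ≠ condDist P x' → ∑ y, star (ψ (x, y)) * ψ (x', y) = 0) :
    depEntropy P ψ = 0 := by
  -- `L` and `N` have the unnormalized conditional states as columns, with and without the classical
  -- label. Orthogonality makes their Gram matrices equal, so both states have the same entropy.
  let L : Matrix (Set.range (condDist P) × Y) X ℂ :=
    Matrix.of fun a x => if condDist P x = a.1 then ψ (x, a.2) else 0
  let N : Matrix Y X ℂ := Matrix.of fun y x => ψ (x, y)
  have hL : depState P ψ = L * Lᴴ := by
    ext ⟨⟨d, hd⟩, y⟩ ⟨⟨d', hd'⟩, y'⟩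
    simp only [depState, Matrix.mul_apply, Matrix.conjTranspose_apply, L, Matrix.of_apply, Subtype.mk.injEq]
    split_ifs with hdd
    · subst hdd
      refine Finset.sum_congr rfl fun x _ => ?_
      split_ifs <;> simp
    · symm
      refine Finset.sum_eq_zero fun x _ => ?_
      by_cases h1 : condDist P x = d
      · have : condDist P x ≠ d' := fun h2 => hdd (h1.symm.trans h2)
        simp [this]
      · simp [h1]
  have hN : reducedState ψ = N * Nᴴ := by
    ext y y'
    simp [reducedState, Matrix.mul_apply, Matrix.conjTranspose_apply, N]
  have hLN : Lᴴ * L = Nᴴ * N := by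
    ext x x'
    simp only [Matrix.mul_apply, Matrix.conjTranspose_apply, L, N, Matrix.of_apply,
      Fintype.sum_prod_type]
    rw [Finset.sum_eq_single (⟨condDist P x, x, rfl⟩ : Set.range (condDist P))]
    · by_cases hx : condDist P x = condDist P x'
      · simp [hx]
      · rw [h x x' hx]
        simp [Ne.symm hx]
    · rintro ⟨d, hd⟩ - hne
      have : condDist P x ≠ d := fun h' => hne (Subtype.ext h'.symm)
      simp [this]
    · simp
  unfold depEntropy
  rw [vonNeumannEntropy_mul_conjTranspose _ L hL, vonNeumannEntropy_mul_conjTranspose _ N hN,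
    
    vonNeumannEntropy_congr _ (Matrix.isHermitian_conjTranspose_mul_self N) hLN, sub_self]

theorem sum_star_mul_self (P : X × Y → ℝ) (ψ : EuclideanSpace ℂ (X × Y))
    (hψ : IsRegularEmbedding P ψ) (x : X) :
    ∑ y, star (ψ (x, y)) * ψ (x, y) = ((∑ y, P (x, y) : ℝ) : ℂ) := by
  push_cast
  refine Finset.sum_congr rfl fun y _ => ?_
  rw [← hψ (x, y)]
  simpa using Complex.conj_mul' (ψ (x, y))

theorem inner_condState (P : X × Y → ℝ) (ψ : EuclideanSpace ℂ (X × Y)) (x x' : X) :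
    inner ℂ (condState P ψ x) (condState P ψ x') =
      ((√(∑ y, P (x, y)) : ℝ) : ℂ)⁻¹ * ((√(∑ y, P (x', y)) : ℝ) : ℂ)⁻¹ *
        ∑ y, star (ψ (x, y)) * ψ (x', y) := by
  simp only [condState, PiLp.inner_apply, RCLike.inner_apply, Finset.mul_sum]
  refine Finset.sum_congr rfl fun y _ => ?_
  simp only [map_mul, map_inv₀, Complex.conj_ofReal, Complex.star_def]
  ring

theorem norm_condState (P : X × Y → ℝ) (ψ : EuclideanSpace ℂ (X × Y))
    (hψ : IsRegularEmbedding P ψ) {x : X} (hx : 0 < ∑ y, P (x, y)) : ‖condState P ψ x‖ = 1 := by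
  have h : inner ℂ (condState P ψ x) (condState P ψ x) = 1 := by
    rw [inner_condState, sum_star_mul_self P ψ hψ, ← mul_inv, ← Complex.ofReal_mul,
      Real.mul_self_sqrt hx.le]
    exact inv_mul_cancel₀ (by exact_mod_cast hx.ne')
  have h2 : ‖condState P ψ x‖ ^ 2 = 1 := by
    rw [@norm_sq_eq_re_inner ℂ, h]
    simp
  nlinarith [norm_nonneg (condState P ψ x)]

theorem norm_condState_apply_sq (P : X × Y → ℝ) (ψ : EuclideanSpace ℂ (X × Y))
    (hψ : IsRegularEmbedding P ψ) {x : X} (hx : 0 < ∑ y, P (x, y)) (y : Y) :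
    ‖condState P ψ x y‖ ^ 2 = condDist P x y := by
  simp only [condState, condDist, norm_mul, norm_inv, mul_pow, hψ (x, y), Complex.norm_real,
    inv_pow, Real.norm_eq_abs, sq_abs, Real.sq_sqrt hx.le]
  ring

/-- If the dependent part of `X` is not determined by the second register, then two outcomes leave
states that are neither orthogonal nor parallel. -/
theorem exists_overlap_of_depEntropy_ne_zero [Fintype X] (P : X × Y → ℝ) (ψ : EuclideanSpace ℂ (X × Y))
    (hψ : IsRegularEmbedding P ψ) (h : depEntropy P ψ ≠ 0) :
    ∃ x₀ x₁ : X, 0 < ∑ y, P (x₀, y) ∧ 0 < ∑ y, P (x₁, y) ∧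
      0 < ‖inner ℂ (condState P ψ x₀) (condState P ψ x₁)‖ ∧
      ‖inner ℂ (condState P ψ x₀) (condState P ψ x₁)‖ < 1 := by
  by_contra! hcon
  refine h (depEntropy_eq_zero_of_orthogonal P ψ fun x x' hd => ?_)
  by_contra hne
  have hP0 : ∀ p, 0 ≤ P p := fun p => by rw [← hψ p]; positivity
  have hpos : ∀ x, (∃ y, ψ (x, y) ≠ 0) → 0 < ∑ y, P (x, y) := by
    rintro x ⟨y, hy⟩
    refine Finset.sum_pos' (fun y _ => hP0 _) ⟨y, Finset.mem_univ _, ?_⟩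
    rw [← hψ]
    positivity
  obtain ⟨y, -, hy⟩ := Finset.exists_ne_zero_of_sum_ne_zero hne
  have hx := hpos x ⟨y, fun h0 => hy (by simp [h0])⟩
  have hx' := hpos x' ⟨y, fun h0 => hy (by simp [h0])⟩
  have hin : inner ℂ (condState P ψ x) (condState P ψ x') ≠ 0 := by
    rw [inner_condState]
    refine mul_ne_zero (mul_ne_zero (inv_ne_zero ?_) (inv_ne_zero ?_)) hne
    · exact_mod_cast (Real.sqrt_pos.2 hx).ne'
    · exact_mod_cast (Real.sqrt_pos.2 hx').ne'
  have h1 := hcon x x' hx hx' (norm_pos_iff.2 hin)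
  have n1 := norm_condState P ψ hψ hx
  have n2 := norm_condState P ψ hψ hx'
  -- Equality in Cauchy–Schwarz: the states differ by a phase, hence give the same distribution in
  -- the computational basis, contradicting `hd`.
  have heq : ‖inner ℂ (condState P ψ x) (condState P ψ x')‖ =
      ‖condState P ψ x‖ * ‖condState P ψ x'‖ :=
    le_antisymm (norm_inner_le_norm _ _) (by rw [n1, n2]; simpa using h1)
  obtain ⟨r, -, hr⟩ := (norm_inner_eq_norm_iff (norm_pos_iff.1 (by rw [n1]; exact one_pos))
    (norm_pos_iff.1 (by rw [n2]; exact one_pos))).1 heq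
  have hr1 : ‖r‖ = 1 := by
    have := congrArg norm hr
    rw [norm_smul, n1, n2, mul_one] at this
    exact this.symm
  refine hd (funext fun y => ?_)
  rw [← norm_condState_apply_sq P ψ hψ hx, ← norm_condState_apply_sq P ψ hψ hx', hr]
  simp [hr1]

end Entropy

/-! ### Bounds on simulators from the honest party's reduced states -/

section Simulators

variable {H D : Type*} [Fintype D]

/-- Partial trace over the dishonest party's register. -/
def honestReduced (σ : Matrix (H × D) (H × D) ℂ) : Matrix H H ℂ :=
  ∑ y, σ.submatrix (fun x => (x, y)) fun x => (x, y)

theorem honestReduced_apply (σ : Matrix (H × D) (H × D) ℂ) (x x' : H) :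
    honestReduced σ x x' = ∑ y, σ (x, y) (x', y) := by
  simp [honestReduced, Matrix.sum_apply]

theorem honestReduced_posSemidef {σ : Matrix (H × D) (H × D) ℂ} (hσ : σ.PosSemidef) :
    (honestReduced σ).PosSemidef :=
  Matrix.posSemidef_sum _ fun _ _ => hσ.submatrix _

theorem initialState_posSemidef [Finite H] (ψ : EuclideanSpace ℂ (H × D)) :
    (initialState ψ).PosSemidef :=
  Matrix.posSemidef_vecMulVec_self_star (ψ : H × D → ℂ)

variable [Fintype H] [DecidableEq H]

/-- Cyclicity of the partial trace: only `Kᴴ * K` matters, and that is what `Instrument.complete`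
controls. -/
theorem honestReduced_kraus (K : Matrix D D ℂ) (σ : Matrix (H × D) (H × D) ℂ) (x x' : H) :
    honestReduced (((1 : Matrix H H ℂ) ⊗ₖ K) * σ * ((1 : Matrix H H ℂ) ⊗ₖ K)ᴴ) x x' =
      ∑ a, ∑ b, (Kᴴ * K) b a * σ (x, a) (x', b) := by
  simp only [honestReduced_apply, Matrix.mul_apply, Matrix.conjTranspose_apply,
    Fintype.sum_prod_type, Matrix.kroneckerMap_apply, Matrix.one_apply, ite_mul, one_mul, zero_mul,
    Finset.sum_ite_irrel, Finset.sum_const_zero, Finset.sum_ite_eq, Finset.mem_univ, if_true,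
    apply_ite star, star_zero, mul_ite, mul_zero, Finset.sum_mul]
  rw [Finset.sum_congr rfl fun y _ => Finset.sum_comm, Finset.sum_comm]
  refine Finset.sum_congr rfl fun a _ => ?_
  rw [Finset.sum_comm]
  refine Finset.sum_congr rfl fun b _ => Finset.sum_congr rfl fun y _ => ?_
  ring

variable [DecidableEq D]

theorem residual_posSemidef (M : Instrument D) (w : unitInterval)
    {σ : Matrix (H × D) (H × D) ℂ} (hσ : σ.PosSemidef) : (M.residual w σ).PosSemidef :=
  Matrix.posSemidef_sum _ fun _ _ => hσ.mul_mul_conjTranspose_same _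

/-- A measurement of the other register does not change the reduced state on average. -/
theorem sum_honestReduced_residual (M : Instrument D) (σ : Matrix (H × D) (H × D) ℂ) :
    ∑ w ∈ M.outcomes, honestReduced (M.residual w σ) = honestReduced σ := by
  ext x x'
  have hadd : ∀ w, honestReduced (M.residual w σ) x x' =
      ∑ k, ∑ a, ∑ b, ((M.kraus w k)ᴴ * M.kraus w k) b a * σ (x, a) (x', b) := by
    intro w
    simp only [← honestReduced_kraus, Instrument.residual, honestReduced_apply, Matrix.sum_apply]
    exact Finset.sum_comm
  rw [Matrix.sum_apply]
  simp only [hadd]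
  have hc : ∀ b a, ∑ w ∈ M.outcomes, ∑ k, ((M.kraus w k)ᴴ * M.kraus w k) b a =
      (1 : Matrix D D ℂ) b a := by
    intro b a
    rw [← M.complete]
    simp [Matrix.sum_apply]
  calc _ = ∑ a, ∑ b, (∑ w ∈ M.outcomes, ∑ k, ((M.kraus w k)ᴴ * M.kraus w k) b a) *
        σ (x, a) (x', b) := by
        simp only [Finset.sum_mul]
        rw [Finset.sum_congr rfl fun w _ => Finset.sum_comm, Finset.sum_comm]
        refine Finset.sum_congr rfl fun a _ => ?_
        rw [Finset.sum_congr rfl fun w _ => Finset.sum_comm, Finset.sum_comm]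
    _ = _ := by simp [hc, honestReduced_apply, Matrix.one_apply]

variable {m : ℕ} {O : Type} [Fintype O]

/-- A multilinear bound on the expected payoff `f`, valid for simulators that output without any
query, holds for all simulators. -/
theorem Simulator.sum_prob_mul_le (F : unitInterval → Instrument D) (f : (Fin m → H) → O → ℝ)
    (C : ℝ) (l : Fin m → Matrix H H ℂ →ₗ[ℝ] ℝ)
    (hf : ∀ σ : Fin m → Matrix (H × D) (H × D) ℂ, (∀ i, (σ i).PosSemidef) → ∀ o,
      ∑ x, (∏ i, (honestReduced (σ i) (x i) (x i)).re) * f x o ≤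
        C * ∏ i, l i (honestReduced (σ i)))
    (S : Simulator m O) (σ : Fin m → Matrix (H × D) (H × D) ℂ) (hσ : ∀ i, (σ i).PosSemidef) :
    ∑ x, ∑ o, S.prob F σ x o * f x o ≤ C * ∏ i, l i (honestReduced (σ i)) := by
  induction S generalizing σ with
  | output o' =>
    refine le_trans (le_of_eq ?_) (hf σ hσ o')
    refine Finset.sum_congr rfl fun x _ => ?_
    rw [Finset.sum_eq_single o']
    · simp [Simulator.prob, honestReduced_apply]
    · intro o _ ho
      simp [Simulator.prob, ho.symm]
    · simp
  | coin p a b iha ihb =>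
    have h1 := mul_le_mul_of_nonneg_left (iha σ hσ) p.2.1
    have h2 := mul_le_mul_of_nonneg_left (ihb σ hσ) (sub_nonneg.2 p.2.2)
    refine le_trans (le_of_eq ?_) ((add_le_add h1 h2).trans (le_of_eq (by ring)))
    simp only [Simulator.prob, Finset.mul_sum, ← Finset.sum_add_distrib]
    refine Finset.sum_congr rfl fun x _ => Finset.sum_congr rfl fun o _ => ?_
    ring
  | query i s next ih =>
    have hup : ∀ w, ∀ j, (Function.update σ i ((F s).residual w (σ i)) j).PosSemidef := by
      intro w j
      rcases eq_or_ne j i with rfl | hj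
      · simpa using residual_posSemidef _ _ (hσ j)
      · simpa [hj] using hσ j
    -- A query changes only the factor `i`. Since `l i` is linear and the reduced states after the
    -- possible answers add up to the old one, the sum of the inductive bounds is the bound before
    -- the query.
    have hprod : ∀ τ, ∏ j, l j (honestReduced (Function.update σ i τ j)) =
        l i (honestReduced τ) * ∏ j ∈ Finset.univ \ {i}, l j (honestReduced (σ j)) := by
      intro τ
      rw [← Finset.prod_update_of_mem (Finset.mem_univ i)]
      refine Finset.prod_congr rfl fun j _ => ?_
      rcases eq_or_ne j i with rfl | hj
      · simp
      · simp [hj]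
    calc _ = ∑ w ∈ (F s).outcomes, ∑ x, ∑ o,
          (next w).prob F (Function.update σ i ((F s).residual w (σ i))) x o * f x o := by
          simp only [Simulator.prob, Finset.sum_mul]
          rw [Finset.sum_congr rfl fun x _ => Finset.sum_comm, Finset.sum_comm]
      _ ≤ ∑ w ∈ (F s).outcomes,
          C * ∏ j, l j (honestReduced (Function.update σ i ((F s).residual w (σ i)) j)) :=
          Finset.sum_le_sum fun w _ => ih w _ (hup w)
      _ = C * (l i (honestReduced (σ i)) *
            ∏ j ∈ Finset.univ \ {i}, l j (honestReduced (σ j))) := by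
          simp only [hprod, ← Finset.mul_sum, ← Finset.sum_mul]
          rw [← map_sum, sum_honestReduced_residual]
      _ = _ := by rw [← hprod, Function.update_eq_self]

/-- This is the multilinear bound for the payoff -1 at the single point `(x, o)`, with `C = 0`. -/
theorem Simulator.prob_nonneg (F : unitInterval → Instrument D) (S : Simulator m O)
    {σ : Fin m → Matrix (H × D) (H × D) ℂ} (hσ : ∀ i, (σ i).PosSemidef) (x : Fin m → H) (o : O) :
    0 ≤ S.prob F σ x o := by
  classical
  have := S.sum_prob_mul_le F (fun x' o' => if x' = x ∧ o' = o then -1 else 0) 0 (fun _ => 0)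
    (fun σ hσ o' => ?_) σ hσ
  · simpa [ite_and, Finset.sum_ite_irrel] using this
  · rw [zero_mul]
    refine Finset.sum_nonpos fun x' _ => mul_nonpos_of_nonneg_of_nonpos
      (Finset.prod_nonneg fun i _ => ?_) (by split_ifs <;> norm_num)
    exact (Complex.le_def.1 ((honestReduced_posSemidef (hσ i)).diag_nonneg (i := x' i))).1

/-- The real part of a matrix entry, as a functional. -/
def reEntry (x : H) : Matrix H H ℂ →ₗ[ℝ] ℝ :=
  Complex.reLm ∘ₗ (Matrix.entryLinearMap ℝ ℂ x x)

theorem Simulator.sum_prob_le (F : unitInterval → Instrument D) (S : Simulator m O)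
    {σ : Fin m → Matrix (H × D) (H × D) ℂ} (hσ : ∀ i, (σ i).PosSemidef) (x : Fin m → H) :
    ∑ o, S.prob F σ x o ≤ ∏ i, (honestReduced (σ i) (x i) (x i)).re := by
  classical
  have := S.sum_prob_mul_le F (fun x' _ => if x' = x then 1 else 0) 1 (fun i => reEntry (x i))
    (fun σ hσ o' => ?_) σ hσ
  · simpa [Finset.sum_ite_irrel, reEntry] using this
  · simp [reEntry]

end Simulators

/-! ### The coherent comparison measurement -/

section Coherent

theorem prod_eq_mul_mul_prod_erase {ι M : Type*} [Fintype ι] [DecidableEq ι] [CommMonoid M]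
    {i j : ι} (hij : i ≠ j) (f : ι → M) :
    ∏ k, f k = f i * f j * ∏ k : {k // k ≠ i ∧ k ≠ j}, f k := by
  rw [← Finset.mul_prod_erase _ f (Finset.mem_univ i), ← Finset.mul_prod_erase _ f
    (Finset.mem_erase.2 ⟨hij.symm, Finset.mem_univ j⟩), mul_assoc]
  congr 2
  refine Finset.prod_subtype _ (fun k => ?_) f
  simp [and_comm]

/-- Split off the coordinates `i` and `j`. -/
def pairEquiv {ι Y : Type*} [DecidableEq ι] {i j : ι} (hij : i ≠ j) :
    (ι → Y) ≃ (Y × Y) × ({k // k ≠ i ∧ k ≠ j} → Y) where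
  toFun y := ((y i, y j), fun k => y k)
  invFun q k := if hi : k = i then q.1.1 else if hj : k = j then q.1.2 else q.2 ⟨k, hi, hj⟩
  left_inv y := by
    ext k
    by_cases hi : k = i
    · simp [hi]
    · by_cases hj : k = j
      · simp [hj, hij.symm]
      · simp [hi, hj]
  right_inv q := by
    refine Prod.ext (Prod.ext ?_ ?_) (funext fun k => ?_)
    · simp
    · simp [hij.symm]
    · simp [k.2.1, k.2.2]

theorem kronecker_mulVec_mul {S T S' T' : Type*} [Fintype S] [Fintype T] (A : Matrix S' S ℂ)
    (B : Matrix T' T ℂ) (v : S → ℂ) (w : T → ℂ) :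
    ((A ⊗ₖ B) *ᵥ fun p => v p.1 * w p.2) = fun p => (A *ᵥ v) p.1 * (B *ᵥ w) p.2 := by
  ext p
  simp only [dotProduct, Matrix.mulVec, Fintype.sum_prod_type, Matrix.kroneckerMap_apply,
    Finset.sum_mul_sum]
  refine Finset.sum_congr rfl fun a _ => Finset.sum_congr rfl fun b _ => ?_
  ring

theorem dotProduct_kronecker_mulVec {S T : Type*} [Fintype S] [Fintype T] (A : Matrix S S ℂ)
    (B : Matrix T T ℂ) (v : S → ℂ) (w : T → ℂ) :
    star (fun p : S × T => v p.1 * w p.2) ⬝ᵥ ((A ⊗ₖ B) *ᵥ fun p => v p.1 * w p.2) =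
      (star v ⬝ᵥ (A *ᵥ v)) * (star w ⬝ᵥ (B *ᵥ w)) := by
  rw [kronecker_mulVec_mul]
  simp only [dotProduct, Fintype.sum_prod_type, Pi.star_apply, star_mul', Finset.sum_mul_sum]
  refine Finset.sum_congr rfl fun a _ => Finset.sum_congr rfl fun b _ => ?_
  ring

/-- Apply a POVM on two registers to the registers `i` and `j`. -/
def POVM.onPair {Y O : Type*} [Fintype Y] [DecidableEq Y] [Fintype O] {m : ℕ}
    (E : POVM (Y × Y) O) {i j : Fin m} (hij : i ≠ j) : POVM (Fin m → Y) O where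
  elem o := (E.elem o ⊗ₖ (1 : Matrix ({k // k ≠ i ∧ k ≠ j} → Y) ({k // k ≠ i ∧ k ≠ j} → Y) ℂ)).submatrix
    (pairEquiv hij) (pairEquiv hij)
  posSemidef o := ((E.posSemidef o).kronecker Matrix.PosSemidef.one).submatrix _
  sum_eq_one := by
    have h : ∑ o, (E.elem o ⊗ₖ (1 : Matrix ({k // k ≠ i ∧ k ≠ j} → Y) ({k // k ≠ i ∧ k ≠ j} → Y) ℂ)) = 1 := by
      rw [← Matrix.one_kronecker_one, ← E.sum_eq_one]
      ext p q
      simp [Matrix.sum_apply, Finset.sum_mul]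
    ext y y'
    have h' := congrFun (congrFun h (pairEquiv hij y)) (pairEquiv hij y')
    rw [Matrix.sum_apply] at h'
    rw [Matrix.sum_apply]
    simp only [Matrix.submatrix_apply, h', Matrix.one_apply, (pairEquiv hij).injective.eq_iff]

/-- The state is a product over registers, so the untouched ones contribute only their squared
norms. -/
theorem attackProb_onPair {H Y O : Type*} [Fintype Y] [DecidableEq Y]
    [Fintype O] {m : ℕ} (ψ : EuclideanSpace ℂ (H × Y)) (E : POVM (Y × Y) O) {i j : Fin m}
    (hij : i ≠ j) (x : Fin m → H) (o : O) :
    attackProb ψ (E.onPair hij) x o =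
      (star (fun p : Y × Y => ψ (x i, p.1) * ψ (x j, p.2)) ⬝ᵥ
          (E.elem o *ᵥ fun p => ψ (x i, p.1) * ψ (x j, p.2)) *
        ∏ k : {k // k ≠ i ∧ k ≠ j}, ∑ y, star (ψ (x k, y)) * ψ (x k, y)).re := by
  have hr : residualVector ψ x = (fun q : (Y × Y) × ({k // k ≠ i ∧ k ≠ j} → Y) =>
      (ψ (x i, q.1.1) * ψ (x j, q.1.2)) * ∏ k : {k // k ≠ i ∧ k ≠ j}, ψ (x k, q.2 k)) ∘ pairEquiv hij := by
    ext y
    simp only [residualVector, prod_eq_mul_mul_prod_erase hij, Function.comp_apply, pairEquiv,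
      Equiv.coe_fn_mk]
  unfold attackProb
  congr 1
  rw [hr]
  have hs : ∀ g : (Y × Y) × ({k // k ≠ i ∧ k ≠ j} → Y) → ℂ,
      star (g ∘ pairEquiv hij) = star g ∘ pairEquiv hij := fun g => rfl
  simp only [POVM.onPair]
  rw [Matrix.submatrix_mulVec_equiv, hs, comp_equiv_dotProduct_comp_equiv]
  have : ((fun q : (Y × Y) × ({k // k ≠ i ∧ k ≠ j} → Y) =>
      (ψ (x i, q.1.1) * ψ (x j, q.1.2)) * ∏ k : {k // k ≠ i ∧ k ≠ j}, ψ (x k, q.2 k)) ∘ pairEquiv hij) ∘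
        (pairEquiv hij).symm = fun q => (ψ (x i, q.1.1) * ψ (x j, q.1.2)) * ∏ k : {k // k ≠ i ∧ k ≠ j}, ψ (x k, q.2 k) := by
    ext q; simp
  rw [this, dotProduct_kronecker_mulVec _ _ (fun p : Y × Y => ψ (x i, p.1) * ψ (x j, p.2))
    (fun z : {k // k ≠ i ∧ k ≠ j} → Y => ∏ k : {k // k ≠ i ∧ k ≠ j}, ψ (x k, z k))]
  congr 1
  rw [Matrix.one_mulVec, Finset.prod_univ_sum, Fintype.piFinset_univ]
  simp only [dotProduct, Pi.star_apply, star_prod, Finset.prod_mul_distrib]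

/-- Extend a POVM along an isometry `B`; the orthogonal complement goes to the outcome `o₀`. -/
def POVM.extend {K S O : Type*} [Fintype K] [DecidableEq K] [Fintype S] [DecidableEq S] [Fintype O]
    [DecidableEq O] (E : POVM K O) (B : Matrix S K ℂ) (hB : Bᴴ * B = 1) (o₀ : O) : POVM S O where
  elem o := B * E.elem o * Bᴴ + if o = o₀ then 1 - B * Bᴴ else 0
  posSemidef o := by
    refine ((E.posSemidef o).mul_mul_conjTranspose_same B).add ?_
    split_ifs
    · have : (1 - B * Bᴴ) = (1 - B * Bᴴ)ᴴ * (1 - B * Bᴴ) := by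
        have h : B * Bᴴ * (B * Bᴴ) = B * Bᴴ := by
          rw [Matrix.mul_assoc, ← Matrix.mul_assoc Bᴴ, hB, Matrix.one_mul]
        simp [Matrix.conjTranspose_sub, Matrix.mul_sub, Matrix.sub_mul, h]
      rw [this]
      exact Matrix.posSemidef_conjTranspose_mul_self _
    · exact Matrix.PosSemidef.zero
  sum_eq_one := by
    rw [Finset.sum_add_distrib, ← Matrix.sum_mul, ← Matrix.mul_sum, E.sum_eq_one]
    simp

theorem POVM.dotProduct_extend {K S O : Type*} [Fintype K] [DecidableEq K] [Fintype S]
    [DecidableEq S] [Fintype O] [DecidableEq O] (E : POVM K O) (B : Matrix S K ℂ)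
    (hB : Bᴴ * B = 1) (o₀ o : O) (γ : ℂ) (u : K → ℂ) :
    star (γ • (B *ᵥ u)) ⬝ᵥ ((E.extend B hB o₀).elem o *ᵥ (γ • (B *ᵥ u))) =
      star γ * γ * (star u ⬝ᵥ (E.elem o *ᵥ u)) := by
  have h1 : (E.extend B hB o₀).elem o *ᵥ (B *ᵥ u) = B *ᵥ (E.elem o *ᵥ u) := by
    simp only [POVM.extend, Matrix.mulVec_mulVec]
    rw [Matrix.add_mul, Matrix.mul_assoc, hB, Matrix.mul_one, Matrix.add_mulVec]
    split_ifs
    · rw [Matrix.sub_mul, Matrix.mul_assoc B, hB]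
      simp
    · simp
  rw [Matrix.mulVec_smul, h1, dotProduct_smul, star_smul, smul_dotProduct, Matrix.star_mulVec,
    ← Matrix.dotProduct_mulVec, Matrix.mulVec_mulVec, hB, Matrix.one_mulVec, smul_eq_mul,
    smul_eq_mul]
  ring

/-- The sign `1` or `-1`. -/
def sgn (e : Bool) : ℝ := if e then 1 else -1

/-- The vectors on two qubits that the comparison measurement projects on. -/
def oddVec (e : Bool) : Fin 2 × Fin 2 → ℂ :=
  fun p => ((!![0, 1; sgn e, 0] : Matrix (Fin 2) (Fin 2) ℝ) p.1 p.2 : ℝ)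

/-- See `oddVec`. -/
def evenVec (r : ℝ) (e : Bool) : Fin 2 × Fin 2 → ℂ :=
  fun p => ((!![r, 0; 0, sgn e] : Matrix (Fin 2) (Fin 2) ℝ) p.1 p.2 : ℝ)

/-- The comparison measurement on two qubits. -/
def qubitComparison (r : ℝ) (hr : r ^ 2 ≤ 1) : POVM (Fin 2 × Fin 2) (Option Bool) where
  elem
    -- The vectors for the two answers together cover everything except the weight 1 - r² on |00⟩.
    | none => (1 - r ^ 2 : ℝ) •
        Matrix.vecMulVec (Pi.single (0, 0) (1 : ℂ)) (star (Pi.single (0, 0) (1 : ℂ)))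
    | some e => (1 / 2 : ℝ) • (Matrix.vecMulVec (oddVec e) (star (oddVec e)) +
        Matrix.vecMulVec (evenVec r e) (star (evenVec r e)))
  posSemidef
    | none => (Matrix.posSemidef_vecMulVec_self_star _).smul (sub_nonneg.2 hr)
    | some _ => ((Matrix.posSemidef_vecMulVec_self_star _).add
        (Matrix.posSemidef_vecMulVec_self_star _)).smul (by norm_num : (0 : ℝ) ≤ 1 / 2)
  sum_eq_one := by
    ext ⟨a, b⟩ ⟨a', b'⟩
    rw [Matrix.sum_apply]
    simp only [Fintype.sum_option, Fintype.sum_bool, Matrix.smul_apply, Matrix.add_apply,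
      Matrix.vecMulVec_apply, Pi.star_apply, oddVec, evenVec, sgn, Matrix.one_apply]
    fin_cases a <;> fin_cases b <;> fin_cases a' <;> fin_cases b' <;>
      simp <;> ring

theorem dotProduct_vecMulVec_mulVec {K : Type*} [Fintype K] (u w : K → ℂ) :
    star u ⬝ᵥ (Matrix.vecMulVec w (star w) *ᵥ u) = star (star w ⬝ᵥ u) * (star w ⬝ᵥ u) := by
  rw [Matrix.vecMulVec_mulVec, dotProduct_smul, Matrix.star_dotProduct]
  simp

/-- The state of a qubit prepared according to `e`; the two states have overlap `s`. -/
def qubitVec (s : ℝ) (e : Bool) : Fin 2 → ℂ :=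
  ![((√((1 + s) / 2) : ℝ) : ℂ), ((sgn e * √((1 - s) / 2) : ℝ) : ℂ)]

/-- The product state has amplitudes cp² and ±cm² on |00⟩ and |11⟩, where the sign is that of a·b,
and ±cp·cm on |01⟩ and |10⟩. The choice of r balances the first two (r·cp² = cm²), so both vectors
of the wrong answer are orthogonal to the state; the right answer gets 2cm²(cp² + cm²) = 1 - s. -/
theorem qubitComparison_value {s r : ℝ} (hs0 : 0 < s) (hs1 : s < 1) (hr : r ^ 2 ≤ 1)
    (hrs : r * (1 + s) = 1 - s) (a b e : Bool) :
    star (fun p : Fin 2 × Fin 2 => qubitVec s a p.1 * qubitVec s b p.2) ⬝ᵥ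
      ((qubitComparison r hr).elem (some e) *ᵥ
        fun p => qubitVec s a p.1 * qubitVec s b p.2) =
      ((if e = decide (a = b) then 1 - s else 0 : ℝ) : ℂ) := by
  set cp := √((1 + s) / 2) with hcp
  set cm := √((1 - s) / 2) with hcm
  have hcp2 : cp * cp = (1 + s) / 2 := Real.mul_self_sqrt (by linarith)
  have hcm2 : cm * cm = (1 - s) / 2 := Real.mul_self_sqrt (by linarith)
  have hrc : r * (cp * cp) = cm * cm := by
    rw [hcp2, hcm2]
    linarith
  have hodd : star (oddVec e) ⬝ᵥ (fun p : Fin 2 × Fin 2 => qubitVec s a p.1 * qubitVec s b p.2) =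
      (((sgn b + sgn e * sgn a) * (cp * cm) : ℝ) : ℂ) := by
    simp [dotProduct, Fintype.sum_prod_type, Fin.sum_univ_two, oddVec, qubitVec, ← hcp, ← hcm]
    ring
  have heven : star (evenVec r e) ⬝ᵥ
      (fun p : Fin 2 × Fin 2 => qubitVec s a p.1 * qubitVec s b p.2) =
      (((1 + sgn e * sgn a * sgn b) * (cm * cm) : ℝ) : ℂ) := by
    rw [add_mul, one_mul]
    nth_rewrite 1 [← hrc]
    simp [dotProduct, Fintype.sum_prod_type, Fin.sum_univ_two, evenVec, qubitVec, ← hcp, ← hcm]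
    ring
  simp only [qubitComparison, Matrix.smul_mulVec, Matrix.add_mulVec, dotProduct_smul,
    dotProduct_add, dotProduct_vecMulVec_mulVec, hodd, heven]
  rw [Complex.star_def, Complex.conj_ofReal, Complex.conj_ofReal, ← Complex.ofReal_mul,
    ← Complex.ofReal_mul, ← Complex.ofReal_add, Complex.real_smul, ← Complex.ofReal_mul]
  congr 1
  have key : 1 / 2 * ((sgn b + sgn e * sgn a) * (cp * cm) * ((sgn b + sgn e * sgn a) * (cp * cm)) +
      (1 + sgn e * sgn a * sgn b) * (cm * cm) * ((1 + sgn e * sgn a * sgn b) * (cm * cm))) =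
      1 / 2 * ((sgn b + sgn e * sgn a) ^ 2 * ((1 + s) / 2 * ((1 - s) / 2)) +
        (1 + sgn e * sgn a * sgn b) ^ 2 * ((1 - s) / 2) ^ 2) := by
    rw [← hcp2, ← hcm2]; ring
  rw [key]
  cases a <;> cases b <;> cases e <;> simp [sgn] <;> ring

theorem exists_norm_eq_one_mul_eq_norm (τ : ℂ) : ∃ ω : ℂ, ‖ω‖ = 1 ∧ ω * τ = ‖τ‖ := by
  rcases eq_or_ne τ 0 with rfl | h
  · exact ⟨1, by simp⟩
  · have h' : (‖τ‖ : ℂ) ≠ 0 := by simpa using h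
    refine ⟨star τ / ‖τ‖, by simp [h], ?_⟩
    rw [div_mul_eq_mul_div, Complex.star_def, Complex.conj_mul']
    field_simp

/-- Two unit vectors with overlap `s` are the images of the standard pair of qubit states. -/
theorem exists_isometry_qubitVec {Y : Type*} [Fintype Y] {s : ℝ} (hs0 : 0 < s) (hs1 : s < 1)
    (a : Bool → Y → ℂ) (hn : ∀ e, star (a e) ⬝ᵥ a e = 1) (hi : star (a true) ⬝ᵥ a false = s) :
    ∃ V : Matrix Y (Fin 2) ℂ, Vᴴ * V = 1 ∧ ∀ e, V *ᵥ qubitVec s e = a e := by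
  have hi' : star (a false) ⬝ᵥ a true = s := by
    rw [Matrix.star_dotProduct, hi]
    simp
  have hcp : 0 < √((1 + s) / 2) := Real.sqrt_pos.2 (by linarith)
  have hcm : 0 < √((1 - s) / 2) := Real.sqrt_pos.2 (by linarith)
  have hcp2 : √((1 + s) / 2) * √((1 + s) / 2) = (1 + s) / 2 := Real.mul_self_sqrt (by linarith)
  have hcm2 : √((1 - s) / 2) * √((1 - s) / 2) = (1 - s) / 2 := Real.mul_self_sqrt (by linarith)
  set cp := √((1 + s) / 2)
  set cm := √((1 - s) / 2)
  have hcp0 : (cp : ℂ) ≠ 0 := by exact_mod_cast hcp.ne'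
  have hcm0 : (cm : ℂ) ≠ 0 := by exact_mod_cast hcm.ne'
  have hcp2' : (cp : ℂ) * cp = (1 + s) / 2 := by exact_mod_cast congrArg (fun t : ℝ => (t : ℂ)) hcp2
  have hcm2' : (cm : ℂ) * cm = (1 - s) / 2 := by exact_mod_cast congrArg (fun t : ℝ => (t : ℂ)) hcm2
  -- The normalized sum and difference: their squared norms before scaling are 2 ± 2s, i.e. 4cp² and
  -- 4cm², and they are orthogonal because the overlap is real.
  let W : Fin 2 → Y → ℂ := ![((2 * cp : ℝ) : ℂ)⁻¹ • (a true + a false),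
    ((2 * cm : ℝ) : ℂ)⁻¹ • (a true - a false)]
  have hW : ∀ k l, star (W k) ⬝ᵥ W l = if k = l then 1 else 0 := by
    intro k l
    fin_cases k <;> fin_cases l <;>
      simp only [W, Fin.zero_eta, Fin.mk_one, Matrix.cons_val_zero, Matrix.cons_val_one,
        star_smul, star_add, star_sub, smul_dotProduct, dotProduct_smul, add_dotProduct,
        sub_dotProduct, dotProduct_add, dotProduct_sub, hn, hi, hi', smul_eq_mul, star_inv₀,
        Complex.star_def, Complex.conj_ofReal] <;> push_cast
    · field_simp
      linear_combination (-4 : ℂ) * hcp2'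
    · ring
    · ring
    · field_simp
      linear_combination (-4 : ℂ) * hcm2'
  refine ⟨Matrix.of fun y k => W k y, ?_, fun e => ?_⟩
  · ext k l
    rw [Matrix.one_apply, ← hW k l]
    simp [Matrix.mul_apply, dotProduct]
  · ext y
    simp only [Matrix.mulVec, dotProduct, Fin.sum_univ_two, Matrix.of_apply, W, qubitVec,
      Matrix.cons_val_zero, Matrix.cons_val_one, Pi.smul_apply, Pi.add_apply, Pi.sub_apply,
      smul_eq_mul]
    change _ * (cp : ℂ) + _ * ((sgn e * cm : ℝ) : ℂ) = _
    push_cast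
    cases e <;> simp only [sgn, if_true, Bool.false_eq_true, if_false] <;> push_cast <;>
      field_simp <;> ring

/-- A joint measurement of the registers `i` and `j` that compares the states for the outcomes `x₀`
and `x₁` without error, and succeeds with probability `1 - s`, where `s` is their overlap. -/
theorem exists_comparison_povm {X Y : Type*} [Fintype Y] [DecidableEq X]
    [DecidableEq Y] (P : X × Y → ℝ) (ψ : EuclideanSpace ℂ (X × Y)) (hψ : IsRegularEmbedding P ψ)
    {x₀ x₁ : X} (h₀ : 0 < ∑ y, P (x₀, y)) (h₁ : 0 < ∑ y, P (x₁, y)) {s : ℝ}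
    (hs : ‖inner ℂ (condState P ψ x₀) (condState P ψ x₁)‖ = s) (hs0 : 0 < s) (hs1 : s < 1)
    {m : ℕ} {i j : Fin m} (hij : i ≠ j) :
    ∃ E : POVM (Fin m → Y) (Option Bool), ∀ x : Fin m → X, (x i = x₀ ∨ x i = x₁) →
      (x j = x₀ ∨ x j = x₁) → ∀ e, attackProb ψ E x (some e) =
        (if e = decide (x i = x j) then 1 - s else 0) * ∏ k, ∑ y, P (x k, y) := by
  classical
  -- The phase ω makes the overlap real and positive, as the qubit model requires; it does not
  -- affect the outcome probabilities.
  obtain ⟨ω, hω, hω'⟩ :=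
    exists_norm_eq_one_mul_eq_norm (inner ℂ (condState P ψ x₀) (condState P ψ x₁))
  rw [hs] at hω'
  have hne : x₀ ≠ x₁ := by
    rintro rfl
    rw [inner_self_eq_norm_sq_to_K, norm_condState P ψ hψ h₀] at hs
    simp at hs
    linarith
  have hself : ∀ x, 0 < ∑ y, P (x, y) →
      star (condState P ψ x : Y → ℂ) ⬝ᵥ (condState P ψ x : Y → ℂ) = 1 := by
    intro x hx
    have : inner ℂ (condState P ψ x) (condState P ψ x) = 1 := by
      rw [inner_self_eq_norm_sq_to_K, norm_condState P ψ hψ hx]; simp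
    rw [← this, EuclideanSpace.inner_eq_star_dotProduct, dotProduct_comm]
  have hωω : star ω * ω = 1 := by
    rw [Complex.star_def, Complex.conj_mul', hω]; simp
  obtain ⟨V, hV, hVa⟩ := exists_isometry_qubitVec hs0 hs1
    (fun e => if e then (condState P ψ x₀ : Y → ℂ) else ω • (condState P ψ x₁ : Y → ℂ))
    (by
      intro e
      cases e
      · simp only [Bool.false_eq_true, if_false, star_smul, smul_dotProduct, dotProduct_smul,
          hself x₁ h₁, smul_eq_mul, mul_one]
        rw [mul_comm, hωω]
      · simpa using hself x₀ h₀)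
    (by
      simp only [if_true, Bool.false_eq_true, if_false, dotProduct_smul, smul_eq_mul]
      rw [← hω', EuclideanSpace.inner_eq_star_dotProduct, dotProduct_comm])
  have hVV : (V ⊗ₖ V)ᴴ * (V ⊗ₖ V) = 1 := by
    rw [Matrix.conjTranspose_kronecker, ← Matrix.mul_kronecker_mul, hV, Matrix.one_kronecker_one]
  have hr : ((1 - s) / (1 + s)) ^ 2 ≤ 1 := by
    have h1 : (1 - s) / (1 + s) ≤ 1 := by rw [div_le_one (by linarith)]; linarith
    have h2 : 0 ≤ (1 - s) / (1 + s) := div_nonneg (by linarith) (by linarith)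
    nlinarith
  have hφ : ∀ x, (x = x₀ ∨ x = x₁) → ∃ γ : ℂ, star γ * γ = ((∑ y, P (x, y) : ℝ) : ℂ) ∧
      ∀ y, ψ (x, y) = γ * (V *ᵥ qubitVec s (decide (x = x₀))) y := by
    rintro x (rfl | rfl)
    · refine ⟨((√(∑ y, P (x, y)) : ℝ) : ℂ), ?_, fun y => ?_⟩
      · rw [Complex.star_def, Complex.conj_ofReal, ← Complex.ofReal_mul, Real.mul_self_sqrt h₀.le]
      · have : ((√(∑ y, P (x, y)) : ℝ) : ℂ) ≠ 0 := by exact_mod_cast (Real.sqrt_pos.2 h₀).ne'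
        simp only [hVa, decide_true, if_true, condState]
        field_simp
    · refine ⟨((√(∑ y, P (x, y)) : ℝ) : ℂ) * star ω, ?_, fun y => ?_⟩
      · rw [star_mul', star_star, Complex.star_def, Complex.conj_ofReal]
        calc _ = ((√(∑ y, P (x, y)) * √(∑ y, P (x, y)) : ℝ) : ℂ) * (star ω * ω) := by
              push_cast; rw [Complex.star_def]; ring
          _ = _ := by rw [hωω, mul_one, Real.mul_self_sqrt h₁.le]
      · have : ((√(∑ y, P (x, y)) : ℝ) : ℂ) ≠ 0 := by exact_mod_cast (Real.sqrt_pos.2 h₁).ne'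
        simp only [hVa, hne.symm, decide_false, Bool.false_eq_true, if_false, condState,
          Pi.smul_apply, smul_eq_mul]
        calc ψ (x, y) = (star ω * ω) * (((√(∑ y, P (x, y)) : ℝ) : ℂ) *
              ((√(∑ y, P (x, y)) : ℝ) : ℂ)⁻¹) * ψ (x, y) := by
              rw [hωω, mul_inv_cancel₀ this]; ring
          _ = _ := by ring
  refine ⟨((qubitComparison _ hr).extend (V ⊗ₖ V) hVV none).onPair hij, fun x hxi hxj e => ?_⟩
  obtain ⟨γ, hγ, hγ'⟩ := hφ _ hxi
  obtain ⟨δ, hδ, hδ'⟩ := hφ _ hxj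
  have hv : (fun p : Y × Y => ψ (x i, p.1) * ψ (x j, p.2)) = (γ * δ) • ((V ⊗ₖ V) *ᵥ
      fun p => qubitVec s (decide (x i = x₀)) p.1 * qubitVec s (decide (x j = x₀)) p.2) := by
    rw [kronecker_mulVec_mul]
    ext p
    simp only [hγ', hδ', Pi.smul_apply, smul_eq_mul]
    ring
  have hdec : decide (decide (x i = x₀) = decide (x j = x₀)) = decide (x i = x j) := by
    rcases hxi with h | h <;> rcases hxj with h' | h' <;> simp [h, h', hne, hne.symm]
  rw [attackProb_onPair, hv, POVM.dotProduct_extend,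
    qubitComparison_value hs0 hs1 hr (by field_simp), prod_eq_mul_mul_prod_erase hij, hdec]
  simp only [sum_star_mul_self P ψ hψ]
  rw [star_mul', show star γ * star δ * (γ * δ) = (star γ * γ) * (star δ * δ) by ring, hγ, hδ,
    ← Complex.ofReal_prod]
  simp only [← Complex.ofReal_mul, Complex.ofReal_re]
  ring

end Coherent

/-! ### Concentration of the number of pairs of positions -/

section Concentration

variable {X : Type*} {m : ℕ}

/-- Expectation of a function of two coordinates under a product of weights. -/
theorem sum_prod_mul_pair [Fintype X] {i j : Fin m} (hij : i ≠ j) (g : Fin m → X → ℝ)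
    (F : X → X → ℝ) :
    ∑ x : Fin m → X, (∏ k, g k (x k)) * F (x i) (x j) =
      (∑ a, ∑ b, g i a * g j b * F a b) * ∏ k : {k // k ≠ i ∧ k ≠ j}, ∑ a, g k a := by
  classical
  rw [Finset.prod_univ_sum, Fintype.piFinset_univ]
  rw [Fintype.sum_equiv (pairEquiv hij) _
    (fun q : (X × X) × ({k // k ≠ i ∧ k ≠ j} → X) =>
      (g i q.1.1 * g j q.1.2 * F q.1.1 q.1.2) * ∏ k : {k // k ≠ i ∧ k ≠ j}, g k (q.2 k))]
  · rw [Fintype.sum_prod_type]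
    simp only [← Finset.mul_sum, ← Finset.sum_mul]
    rw [Fintype.sum_prod_type]
  · intro x
    rw [prod_eq_mul_mul_prod_erase hij]
    simp only [pairEquiv, Equiv.coe_fn_mk]
    ring

theorem sum_prod_eq_one [Fintype X] {q : X → ℝ} (hq1 : ∑ a, q a = 1) :
    ∑ x : Fin m → X, ∏ k, q (x k) = 1 := by
  classical
  have := Finset.prod_univ_sum (fun _ : Fin m => (Finset.univ : Finset X)) (fun _ => q)
  rw [Fintype.piFinset_univ] at this
  rw [← this]
  simp [hq1]

variable [DecidableEq X]

/-- The number of occurrences of `α` in `x`. -/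
def occurrences (x : Fin m → X) (α : X) : ℝ := ∑ i, if x i = α then 1 else 0

/-- Independence kills the off-diagonal covariances, and each of the m variances is at most 1. -/
theorem sum_occurrences_sub_sq_le [Fintype X] {q : X → ℝ} (hq0 : ∀ a, 0 ≤ q a) (hq1 : ∑ a, q a = 1) (α : X) :
    ∑ x : Fin m → X, (∏ k, q (x k)) * (occurrences x α - m * q α) ^ 2 ≤ m := by
  have hqα : q α ≤ 1 := hq1 ▸ Finset.single_le_sum (fun a _ => hq0 a) (Finset.mem_univ α)
  let f : X → ℝ := fun a => (if a = α then 1 else 0) - q α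
  have hmean : ∑ a, q a * f a = 0 := by
    simp [f, mul_sub, ← Finset.sum_mul, hq1]
  have hf : ∀ a, f a * f a ≤ 1 := by
    intro a
    have := hq0 α
    simp only [f]
    split_ifs <;> nlinarith
  have hocc : ∀ x : Fin m → X, (occurrences x α - m * q α) ^ 2 = ∑ i, ∑ j, f (x i) * f (x j) := by
    intro x
    rw [← Finset.sum_mul_sum, ← sq]
    simp [f, occurrences, Finset.sum_sub_distrib]
  calc _ = ∑ i, ∑ j, ∑ x : Fin m → X, (∏ k, q (x k)) * (f (x i) * f (x j)) := by
        simp only [hocc, Finset.mul_sum]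
        rw [Finset.sum_comm]
        exact Finset.sum_congr rfl fun i _ => Finset.sum_comm
    _ ≤ ∑ i : Fin m, ∑ j : Fin m, if i = j then 1 else 0 := by
        refine Finset.sum_le_sum fun i _ => Finset.sum_le_sum fun j _ => ?_
        split_ifs with hij
        · subst hij
          rw [← sum_prod_eq_one (m := m) hq1]
          refine Finset.sum_le_sum fun x _ => ?_
          have := Finset.prod_nonneg fun k (_ : k ∈ Finset.univ) => hq0 (x k)
          nlinarith [hf (x i)]
        · rw [sum_prod_mul_pair hij (fun _ => q) fun a b => f a * f b]
          have : ∑ a, ∑ b, q a * q b * (f a * f b) = (∑ a, q a * f a) * ∑ b, q b * f b := by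
            rw [Finset.sum_mul_sum]
            refine Finset.sum_congr rfl fun a _ => Finset.sum_congr rfl fun b _ => ?_
            ring
          rw [this, hmean]
          simp
    _ = m := by simp

theorem sum_abs_occurrences_sub_le [Fintype X] (hm : 0 < m) {q : X → ℝ} (hq0 : ∀ a, 0 ≤ q a)
    (hq1 : ∑ a, q a = 1) (α : X) :
    ∑ x : Fin m → X, (∏ k, q (x k)) * |occurrences x α / m - q α| ≤ 1 / √m := by
  have hm' : (0 : ℝ) < m := by exact_mod_cast hm
  have hs : 0 < √(m : ℝ) := Real.sqrt_pos.2 hm'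
  have hss : √(m : ℝ) * √m = m := Real.mul_self_sqrt hm'.le
  -- The inequality of arithmetic and geometric means, from (|t| - √m)² ≥ 0; it turns the second
  -- moment bound into one on the first absolute moment.
  have hpt : ∀ t : ℝ, |t / m| ≤ (t ^ 2 / (m * √m) + 1 / √m) / 2 := by
    intro t
    rw [abs_div, abs_of_pos hm', ← sq_abs t, div_add_div _ _ (by positivity) (by positivity),
      div_div, div_le_div_iff₀ hm' (by positivity)]
    set r := √(m : ℝ)
    rw [← hss]
    have h2 : 0 ≤ (|t| - r) ^ 2 * r ^ 3 := by positivity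
    nlinarith [h2]
  calc _ ≤ ∑ x : Fin m → X, (∏ k, q (x k)) *
        (((occurrences x α - m * q α) ^ 2 / (m * √m) + 1 / √m) / 2) := by
        refine Finset.sum_le_sum fun x _ => mul_le_mul_of_nonneg_left ?_
          (Finset.prod_nonneg fun k _ => hq0 _)
        refine le_trans (le_of_eq ?_) (hpt _)
        congr 1
        field_simp
    _ = (∑ x : Fin m → X, (∏ k, q (x k)) * (occurrences x α - m * q α) ^ 2) * (1 / (2 * (m * √m)))
        + (∑ x : Fin m → X, ∏ k, q (x k)) * (1 / (2 * √m)) := by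
        rw [Finset.sum_mul, Finset.sum_mul, ← Finset.sum_add_distrib]
        refine Finset.sum_congr rfl fun x _ => ?_
        field_simp
    _ ≤ m * (1 / (2 * (m * √m))) + 1 * (1 / (2 * √m)) := by
        rw [sum_prod_eq_one hq1]
        gcongr
        exact sum_occurrences_sub_sq_le hq0 hq1 α
    _ = 1 / √m := by field_simp; norm_num

/-- The product of the counts includes the coinciding positions i = j, of which there are at most m.
-/
theorem abs_card_pairPositions_sub_le (x : Fin m → X) (α β : X) :
    |((pairPositions x α β).card : ℝ) - occurrences x α * occurrences x β| ≤ m := by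
  have hc : ((pairPositions x α β).card : ℝ) =
      ∑ i, ∑ j, if i ≠ j ∧ x i = α ∧ x j = β then (1 : ℝ) else 0 := by
    rw [pairPositions, Finset.card_filter, ← Finset.univ_product_univ, Finset.sum_product]
    push_cast
    rfl
  rw [hc, occurrences, occurrences, Finset.sum_mul_sum, ← Finset.sum_sub_distrib]
  refine (Finset.abs_sum_le_sum_abs _ _).trans ?_
  calc _ ≤ ∑ i : Fin m, (1 : ℝ) := Finset.sum_le_sum fun i _ => ?_
    _ = m := by simp
  rw [← Finset.sum_sub_distrib, Finset.sum_eq_single i]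
  · by_cases h1 : x i = α
    · by_cases h2 : α = β <;> simp [h1, h2]
    · simp [h1]
  · intro j _ hj
    by_cases h1 : x i = α <;> by_cases h2 : x j = β <;> simp [h1, h2, hj.symm]
  · simp

/-- The relative deviation of the number of pairs from its mean. -/
def pairDeviation (q : X → ℝ) (x : Fin m → X) (α β : X) : ℝ :=
  |1 - (pairPositions x α β).card / (m ^ 2 * q α * q β)|

theorem sum_pairDeviation_le [Fintype X] (hm : 0 < m) {q : X → ℝ} (hq0 : ∀ a, 0 ≤ q a)
    (hq1 : ∑ a, q a = 1) {α β : X} (hα : 0 < q α) (hβ : 0 < q β) :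
    ∑ x : Fin m → X, (∏ k, q (x k)) * pairDeviation q x α β ≤ 3 / (q α * q β) / √m := by
  have hm' : (0 : ℝ) < m := by exact_mod_cast hm
  have hm1 : (1 : ℝ) ≤ m := by exact_mod_cast hm
  have hs : 0 < √(m : ℝ) := Real.sqrt_pos.2 hm'
  have hms : 1 / (m : ℝ) ≤ 1 / √m := by
    refine one_div_le_one_div_of_le hs ?_
    rw [Real.sqrt_le_left hm'.le]
    nlinarith
  have hqβ : q β ≤ 1 := hq1 ▸ Finset.single_le_sum (fun a _ => hq0 a) (Finset.mem_univ β)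
  -- Two frequency deviations and the coinciding positions: each has mean at most 1/√m, whence the
  -- constant 3.
  have hpt : ∀ x : Fin m → X, pairDeviation q x α β ≤ (|occurrences x α / m - q α| +
      |occurrences x β / m - q β| + 1 / √m) * (1 / (q α * q β)) := by
    intro x
    have h0 : 0 ≤ occurrences x α / m := by
      refine div_nonneg (Finset.sum_nonneg fun i _ => ?_) hm'.le
      split_ifs <;> norm_num
    have h1 : occurrences x α / m ≤ 1 := by
      rw [div_le_one hm']
      calc occurrences x α ≤ ∑ i : Fin m, (1 : ℝ) := Finset.sum_le_sum fun i _ => by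
            split_ifs <;> norm_num
        _ = m := by simp
    have hN := abs_card_pairPositions_sub_le x α β
    set N : ℝ := ((pairPositions x α β).card : ℝ) with hNdef
    set a := occurrences x α / m with ha
    set b := occurrences x β / m with hb
    have hN' : |N / m ^ 2 - a * b| ≤ 1 / m := by
      have : N / m ^ 2 - a * b = (N - occurrences x α * occurrences x β) / m ^ 2 := by
        rw [ha, hb]; field_simp
      rw [this, abs_div, abs_of_pos (by positivity : (0 : ℝ) < m ^ 2),
        div_le_div_iff₀ (by positivity) hm']
      nlinarith
    have hprod : |a * b - q α * q β| ≤ |a - q α| + |b - q β| := by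
      have : a * b - q α * q β = (a - q α) * q β + a * (b - q β) := by ring
      rw [this]
      refine (abs_add_le _ _).trans (add_le_add ?_ ?_)
      · rw [abs_mul, abs_of_pos hβ]
        exact mul_le_of_le_one_right (abs_nonneg _) hqβ
      · rw [abs_mul, abs_of_nonneg h0]
        exact mul_le_of_le_one_left (abs_nonneg _) h1
    have heq : 1 - N / (m ^ 2 * q α * q β) =
        -((N / m ^ 2 - a * b) + (a * b - q α * q β)) * (1 / (q α * q β)) := by
      field_simp
      ring
    rw [pairDeviation, heq, abs_mul, abs_neg, abs_of_pos (by positivity : 0 < 1 / (q α * q β))]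
    refine mul_le_mul_of_nonneg_right ?_ (by positivity)
    have := abs_add_le (N / m ^ 2 - a * b) (a * b - q α * q β)
    linarith
  calc _ ≤ ∑ x : Fin m → X, (∏ k, q (x k)) * ((|occurrences x α / m - q α| +
      |occurrences x β / m - q β| + 1 / √m) * (1 / (q α * q β))) :=
        Finset.sum_le_sum fun x _ => mul_le_mul_of_nonneg_left (hpt x)
          (Finset.prod_nonneg fun k _ => hq0 _)
    _ = (∑ x : Fin m → X, (∏ k, q (x k)) * |occurrences x α / m - q α| +
        ∑ x : Fin m → X, (∏ k, q (x k)) * |occurrences x β / m - q β| +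
        (∑ x : Fin m → X, ∏ k, q (x k)) * (1 / √m)) * (1 / (q α * q β)) := by
        rw [Finset.sum_mul, ← Finset.sum_add_distrib, ← Finset.sum_add_distrib, Finset.sum_mul]
        refine Finset.sum_congr rfl fun x _ => ?_
        ring
    _ ≤ (1 / √m + 1 / √m + 1 * (1 / √m)) * (1 / (q α * q β)) := by
        rw [sum_prod_eq_one hq1]
        gcongr
        · exact sum_abs_occurrences_sub_le hm hq0 hq1 α
        · exact sum_abs_occurrences_sub_le hm hq0 hq1 β
    _ = _ := by field_simp; norm_num

/-- The announcement probability with the number of pairs replaced by (about) its mean. -/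
def meanAnnounceProb (q : X → ℝ) (x₀ x₁ : X) (x : Fin m → X) (h : Fin m × Fin m) : ℝ :=
  if h.1 ≠ h.2 ∧ (x h.1 = x₀ ∨ x h.1 = x₁) ∧ (x h.2 = x₀ ∨ x h.2 = x₁) then
    1 / 4 * (1 / (m ^ 2 * q (x h.1) * q (x h.2)))
  else 0

/-- The sum of the relative deviations over the four kinds of pairs. -/
def totalDeviation (q : X → ℝ) (x₀ x₁ : X) (x : Fin m → X) : ℝ :=
  ∑ α ∈ {x₀, x₁}, ∑ β ∈ {x₀, x₁}, pairDeviation q x α β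

theorem sum_eq_sum_pairPositions {x₀ x₁ : X} (x : Fin m → X) (F : Fin m × Fin m → ℝ)
    (hF : ∀ h, ¬ (h.1 ≠ h.2 ∧ (x h.1 = x₀ ∨ x h.1 = x₁) ∧ (x h.2 = x₀ ∨ x h.2 = x₁)) → F h = 0) :
    ∑ h, F h = ∑ α ∈ {x₀, x₁}, ∑ β ∈ {x₀, x₁}, ∑ h ∈ pairPositions x α β, F h := by
  simp only [pairPositions, Finset.sum_filter]
  rw [Finset.sum_congr rfl fun α _ => Finset.sum_comm, Finset.sum_comm]
  refine Finset.sum_congr rfl fun h _ => ?_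
  by_cases hh : h.1 ≠ h.2 ∧ (x h.1 = x₀ ∨ x h.1 = x₁) ∧ (x h.2 = x₀ ∨ x h.2 = x₁)
  · obtain ⟨h1, h2, h3⟩ := hh
    simp only [h1, ne_eq, not_false_eq_true, true_and, ite_and, Finset.sum_ite_irrel,
      Finset.sum_const_zero, Finset.sum_ite_eq]
    simp [h2, h3]
  · simp [hF h hh]

/-- For each kind (α, β) both probabilities are constant on the N pairs. With w = m²q(α)q(β), the
differences sum to at most |1 - N/w|/4, or to N/(4w) ≤ (1 + |1 - N/w|)/4 on an abort. In total this
is 5/4 of the deviation, rounded up to 2. -/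
theorem sum_abs_announceProb_sub_le (hm : 0 < m) {q : X → ℝ} {x₀ x₁ : X} (hne : x₀ ≠ x₁)
    (h₀ : 0 < q x₀) (h₁ : 0 < q x₁) (x : Fin m → X) :
    ∑ h, |announceProb x₀ x₁ x h - meanAnnounceProb q x₀ x₁ x h| ≤
      2 * totalDeviation q x₀ x₁ x := by
  have hm' : (0 : ℝ) < m := by exact_mod_cast hm
  let A : ℝ := if (pairPositions x x₀ x₀).Nonempty ∧ (pairPositions x x₁ x₁).Nonempty then 0 else 1
  have hdev0 : ∀ α β, 0 ≤ pairDeviation q x α β := fun α β => abs_nonneg _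
  have htot : totalDeviation q x₀ x₁ x = pairDeviation q x x₀ x₀ + pairDeviation q x x₀ x₁ +
      (pairDeviation q x x₁ x₀ + pairDeviation q x x₁ x₁) := by
    simp [totalDeviation, Finset.sum_pair hne]
  -- `A` indicates an abort; then some kind has no pairs, and its relative deviation is exactly 1.
  have hA : A ≤ totalDeviation q x₀ x₁ x := by
    have hemp : ∀ α β, ¬ (pairPositions x α β).Nonempty → pairDeviation q x α β = 1 := by
      intro α β h
      rw [Finset.not_nonempty_iff_eq_empty] at h
      simp [pairDeviation, h]
    rw [htot]
    have := hdev0 x₀ x₀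
    have := hdev0 x₀ x₁
    have := hdev0 x₁ x₀
    have := hdev0 x₁ x₁
    simp only [A]
    split_ifs with h
    · linarith
    · rcases not_and_or.1 h with h | h
      · linarith [hemp _ _ h]
      · linarith [hemp _ _ h]
  rw [sum_eq_sum_pairPositions (x₀ := x₀) (x₁ := x₁) x]
  · have hterm : ∀ α ∈ ({x₀, x₁} : Finset X), ∀ β ∈ ({x₀, x₁} : Finset X),
        ∑ h ∈ pairPositions x α β, |announceProb x₀ x₁ x h - meanAnnounceProb q x₀ x₁ x h| ≤
          1 / 4 * (A + pairDeviation q x α β) := by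
      intro α hα β hβ
      have hqα : 0 < q α := by
        rcases Finset.mem_insert.1 hα with rfl | h
        · exact h₀
        · rw [Finset.mem_singleton.1 h]; exact h₁
      have hqβ : 0 < q β := by
        rcases Finset.mem_insert.1 hβ with rfl | h
        · exact h₀
        · rw [Finset.mem_singleton.1 h]; exact h₁
      have hw : 0 < (m : ℝ) ^ 2 * q α * q β := by positivity
      have hconst : ∀ h ∈ pairPositions x α β,
          |announceProb x₀ x₁ x h - meanAnnounceProb q x₀ x₁ x h| =
            |1 / 4 * ((1 - A) * (1 / ((pairPositions x α β).card : ℝ))) -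
              1 / 4 * (1 / (m ^ 2 * q α * q β))| := by
        intro h hh
        obtain ⟨-, h1, h2, h3⟩ := Finset.mem_filter.1 hh
        have hα' : α = x₀ ∨ α = x₁ := by simpa using hα
        have hβ' : β = x₀ ∨ β = x₁ := by simpa using hβ
        simp only [announceProb, meanAnnounceProb, h1, h2, h3, hα', hβ', ne_eq, not_false_eq_true,
          and_true, if_true, A]
        split_ifs <;> simp
      rw [Finset.sum_congr rfl hconst, Finset.sum_const, nsmul_eq_mul, pairDeviation]
      set N : ℝ := ((pairPositions x α β).card : ℝ) with hN
      have hN0 : 0 ≤ N := Nat.cast_nonneg _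
      set w := (m : ℝ) ^ 2 * q α * q β
      simp only [A]
      split_ifs with hab
      · rcases hN0.eq_or_lt with h0 | hpos
        · rw [← h0]; simp
        · rw [← abs_of_pos hpos, ← abs_mul, abs_of_pos hpos, zero_add,
            ← abs_of_pos (by norm_num : (0 : ℝ) < 1 / 4), ← abs_mul,
            abs_of_pos (by norm_num : (0 : ℝ) < 1 / 4)]
          refine le_of_eq (congrArg _ ?_)
          field_simp
          ring
      · have h2 : |1 / 4 * ((1 - 1) * (1 / N)) - 1 / 4 * (1 / w)| = 1 / 4 * (1 / w) := by
          rw [sub_self, zero_mul, mul_zero, zero_sub, abs_neg]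
          exact abs_of_pos (by positivity)
        rw [h2]
        have h3 := neg_abs_le (1 - N / w)
        have h4 : N * (1 / 4 * (1 / w)) = 1 / 4 * (N / w) := by ring
        rw [h4]
        linarith
    refine (Finset.sum_le_sum fun α hα => Finset.sum_le_sum fun β hβ => hterm α hα β hβ).trans ?_
    simp only [Finset.sum_pair hne]
    rw [htot] at hA ⊢
    have := hdev0 x₀ x₀
    have := hdev0 x₀ x₁
    have := hdev0 x₁ x₀
    have := hdev0 x₁ x₁
    linarith
  · intro h hh
    have h1 : announceProb x₀ x₁ x h = 0 := by
      rw [announceProb, if_neg]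
      rintro ⟨-, -, h1⟩
      exact hh h1
    rw [h1, meanAnnounceProb, if_neg hh]
    simp

/-- A loss of 1/4 for the mean weights and 2 for replacing them, rounded up to 3. -/
theorem le_sum_announceProb (hm : 0 < m) {q : X → ℝ} {x₀ x₁ : X} (hne : x₀ ≠ x₁)
    (h₀ : 0 < q x₀) (h₁ : 0 < q x₁) (x : Fin m → X) :
    1 - 3 * totalDeviation q x₀ x₁ x ≤ ∑ h, announceProb x₀ x₁ x h := by
  have hmean : 1 - 1 / 4 * totalDeviation q x₀ x₁ x ≤ ∑ h, meanAnnounceProb q x₀ x₁ x h := by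
    rw [sum_eq_sum_pairPositions (x₀ := x₀) (x₁ := x₁) x]
    · have hterm : ∀ α ∈ ({x₀, x₁} : Finset X), ∀ β ∈ ({x₀, x₁} : Finset X),
          1 / 4 * (1 - pairDeviation q x α β) ≤
            ∑ h ∈ pairPositions x α β, meanAnnounceProb q x₀ x₁ x h := by
        intro α hα β hβ
        have hconst : ∀ h ∈ pairPositions x α β, meanAnnounceProb q x₀ x₁ x h =
            1 / 4 * (1 / (m ^ 2 * q α * q β)) := by
          intro h hh
          obtain ⟨-, h1, h2, h3⟩ := Finset.mem_filter.1 hh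
          have hα' : α = x₀ ∨ α = x₁ := by simpa using hα
          have hβ' : β = x₀ ∨ β = x₁ := by simpa using hβ
          simp only [meanAnnounceProb, h1, h2, h3, hα', hβ', ne_eq, not_false_eq_true,
            and_true, if_true]
        rw [Finset.sum_congr rfl hconst, Finset.sum_const, nsmul_eq_mul, pairDeviation]
        have h3 := le_abs_self (1 - (pairPositions x α β).card / ((m : ℝ) ^ 2 * q α * q β))
        have h4 : ((pairPositions x α β).card : ℝ) * (1 / 4 * (1 / ((m : ℝ) ^ 2 * q α * q β))) =
          1 / 4 * ((pairPositions x α β).card / ((m : ℝ) ^ 2 * q α * q β)) := by ring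
        rw [h4]
        linarith
      refine le_trans (le_of_eq ?_)
        (Finset.sum_le_sum fun α hα => Finset.sum_le_sum fun β hβ => hterm α hα β hβ)
      simp only [totalDeviation, Finset.sum_pair hne]
      ring
    · intro h hh
      rw [meanAnnounceProb, if_neg hh]
  have hdiff : ∑ h, meanAnnounceProb q x₀ x₁ x h - ∑ h, announceProb x₀ x₁ x h ≤
      2 * totalDeviation q x₀ x₁ x := by
    rw [← Finset.sum_sub_distrib]
    refine le_trans (Finset.sum_le_sum fun h _ => ?_)
      (sum_abs_announceProb_sub_le hm hne h₀ h₁ x)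
    rw [abs_sub_comm]
    exact le_abs_self _
  have : 0 ≤ totalDeviation q x₀ x₁ x :=
    Finset.sum_nonneg fun α _ => Finset.sum_nonneg fun β _ => abs_nonneg _
  linarith

theorem sum_totalDeviation_le [Fintype X] (hm : 0 < m) {q : X → ℝ} (hq0 : ∀ a, 0 ≤ q a)
    (hq1 : ∑ a, q a = 1) {x₀ x₁ : X} (h₀ : 0 < q x₀) (h₁ : 0 < q x₁) :
    ∑ x : Fin m → X, (∏ k, q (x k)) * totalDeviation q x₀ x₁ x ≤
      (∑ α ∈ {x₀, x₁}, ∑ β ∈ {x₀, x₁}, 3 / (q α * q β)) / √m := by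
  have hpos : ∀ α ∈ ({x₀, x₁} : Finset X), 0 < q α := by
    intro α hα
    rcases Finset.mem_insert.1 hα with rfl | h
    · exact h₀
    · rw [Finset.mem_singleton.1 h]; exact h₁
  simp only [totalDeviation, Finset.mul_sum, Finset.sum_div]
  rw [Finset.sum_comm]
  refine Finset.sum_le_sum fun α hα => ?_
  rw [Finset.sum_comm]
  exact Finset.sum_le_sum fun β hβ => sum_pairDeviation_le hm hq0 hq1 (hpos α hα) (hpos β hβ)

end Concentration

/-! ### Separable strategies -/

section Separable

/-- Product measurements cannot do better than identifying both states separately. -/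
theorem separable_payoff_le {c a₀ a₁ b₀ b₁ ka kb : ℝ} (hc : 1 ≤ c) (ha₀ : 0 ≤ a₀) (ha₁ : 0 ≤ a₁)
    (hb₀ : 0 ≤ b₀) (hb₁ : 0 ≤ b₁) (hka : 0 ≤ ka) (hkb : 0 ≤ kb) (hka₀ : a₀ - c * a₁ ≤ ka)
    (hka₁ : a₁ - c * a₀ ≤ ka) (hkb₀ : b₀ - c * b₁ ≤ kb) (hkb₁ : b₁ - c * b₀ ≤ kb) :
    a₀ * b₀ + a₁ * b₁ - 2 * c * (a₀ * b₁ + a₁ * b₀) ≤ ka * kb := by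
  have hc0 : 0 ≤ c := by linarith
  have h01 : 0 ≤ a₀ * b₁ := mul_nonneg ha₀ hb₁
  have h10 : 0 ≤ a₁ * b₀ := mul_nonneg ha₁ hb₀
  have h00 : 0 ≤ a₀ * b₀ := mul_nonneg ha₀ hb₀
  have h11 : 0 ≤ a₁ * b₁ := mul_nonneg ha₁ hb₁
  have hc2 : 1 ≤ c ^ 2 := by nlinarith
  have e01 : 0 ≤ c * (a₀ * b₁) := mul_nonneg hc0 h01
  have e10 : 0 ≤ c * (a₁ * b₀) := mul_nonneg hc0 h10
  -- Both registers favour the first state by a factor c. Expanding (a₀ - c·a₁)(b₀ - c·b₁) gives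
  -- c²·a₁b₁, which covers a₁b₁ as c ≥ 1.
  by_cases hA : 0 ≤ a₀ - c * a₁ ∧ 0 ≤ b₀ - c * b₁
  · have := mul_le_mul hka₀ hkb₀ hA.2 hka
    nlinarith [mul_le_mul_of_nonneg_right hc2 h11]
  by_cases hB : 0 ≤ a₁ - c * a₀ ∧ 0 ≤ b₁ - c * b₀
  · have := mul_le_mul hka₁ hkb₁ hB.2 hka
    nlinarith [mul_le_mul_of_nonneg_right hc2 h00]
  -- In the remaining case each correct term is at most c times the sum of the wrong ones, so the
  -- doubled penalty makes the payoff nonpositive.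
  have hA' : a₀ * b₀ ≤ c * (a₀ * b₁ + a₁ * b₀) := by
    rcases not_and_or.1 hA with h | h
    · nlinarith [mul_le_mul_of_nonneg_right (le_of_not_ge h) hb₀]
    · nlinarith [mul_le_mul_of_nonneg_left (le_of_not_ge h) ha₀]
  have hB' : a₁ * b₁ ≤ c * (a₀ * b₁ + a₁ * b₀) := by
    rcases not_and_or.1 hB with h | h
    · nlinarith [mul_le_mul_of_nonneg_right (le_of_not_ge h) hb₁]
    · nlinarith [mul_le_mul_of_nonneg_left (le_of_not_ge h) ha₁]
  have : 0 ≤ ka * kb := mul_nonneg hka hkb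
  linarith

theorem honestReduced_initialState_apply_self {X Y : Type*} [Fintype Y] (P : X × Y → ℝ) (ψ : EuclideanSpace ℂ (X × Y))
    (hψ : IsRegularEmbedding P ψ) (x : X) :
    (honestReduced (initialState ψ) x x).re = ∑ y, P (x, y) := by
  rw [honestReduced_apply, ← Complex.ofReal_re (∑ y, P (x, y)), ← sum_star_mul_self P ψ hψ]
  simp only [initialState, mul_comm]

variable {X Y : Type*} [Fintype X]

/-- The quadratic form of a matrix at `v`, as a functional of the matrix. -/
def quadForm (v : X → ℂ) : Matrix X X ℂ →ₗ[ℝ] ℝ where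
  toFun G := (star v ⬝ᵥ (G *ᵥ v)).re
  map_add' G G' := by simp [Matrix.add_mulVec]
  map_smul' r G := by simp [Matrix.smul_mulVec]

/-- The real part of the trace, as a functional. -/
def reTrace : Matrix X X ℂ →ₗ[ℝ] ℝ where
  toFun G := ∑ x, (G x x).re
  map_add' G G' := by simp [Finset.sum_add_distrib]
  map_smul' r G := by simp [Finset.mul_sum]

theorem quadForm_nonneg {G : Matrix X X ℂ} (hG : G.PosSemidef) (v : X → ℂ) : 0 ≤ quadForm v G :=
  hG.re_dotProduct_nonneg v

variable [DecidableEq X]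

theorem quadForm_single_sub {G : Matrix X X ℂ} (hG : G.IsHermitian) {x₀ x₁ : X}
    (z₀ z₁ : ℂ) (a b : ℝ) :
    quadForm (Pi.single x₀ (a * z₀) - Pi.single x₁ (b * z₁)) G =
      a ^ 2 * (‖z₀‖ ^ 2 * (G x₀ x₀).re) + b ^ 2 * (‖z₁‖ ^ 2 * (G x₁ x₁).re) -
        2 * (a * b * (star z₀ * G x₀ x₁ * z₁).re) := by
  have h10 : G x₁ x₀ = star (G x₀ x₁) := (hG.apply x₁ x₀).symm
  have e : star (Pi.single x₀ (a * z₀) - Pi.single x₁ (b * z₁) : X → ℂ) ⬝ᵥ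
      (G *ᵥ (Pi.single x₀ (a * z₀) - Pi.single x₁ (b * z₁))) =
      (star (a * z₀) * (G x₀ x₀ * (a * z₀)) - star (a * z₀) * (G x₀ x₁ * (b * z₁))) -
      (star (b * z₁) * (G x₁ x₀ * (a * z₀)) - star (b * z₁) * (G x₁ x₁ * (b * z₁))) := by
    rw [star_sub, ← Pi.single_star, ← Pi.single_star, sub_dotProduct, single_dotProduct,
      single_dotProduct, Matrix.mulVec_sub]
    simp only [Pi.sub_apply, Matrix.mulVec_single]
    simp [mul_sub]
  have hn : ∀ z : ℂ, ‖z‖ ^ 2 = z.re * z.re + z.im * z.im := by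
    intro z
    rw [← Complex.normSq_eq_norm_sq, Complex.normSq_apply]
  have hd : ∀ x, (G x x).im = 0 := by
    intro x
    have := congrArg Complex.im (hG.apply x x)
    simp at this
    linarith
  change Complex.re _ = _
  rw [e, h10, hn, hn]
  simp [hd]
  ring

/-- The slack in each inequality is (1 - δ)⁻¹δ⁻¹ times the form at δz₀ - z₁, respectively z₀ - δz₁,
hence nonnegative. Thus one linear functional of `G` dominates the evidence for both outcomes. -/
theorem le_quadForm {G : Matrix X X ℂ} (hG : G.PosSemidef) {x₀ x₁ : X} (z₀ z₁ : ℂ) {δ : ℝ}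
    (hδ : 0 < δ) (hδ1 : δ < 1) :
    let k := (1 - δ)⁻¹ * quadForm (Pi.single x₀ z₀ - Pi.single x₁ z₁) G
    let a₀ := ‖z₀‖ ^ 2 * (G x₀ x₀).re
    let a₁ := ‖z₁‖ ^ 2 * (G x₁ x₁).re
    a₀ - δ⁻¹ * a₁ ≤ k ∧ a₁ - δ⁻¹ * a₀ ≤ k := by
  intro k a₀ a₁
  have h11 := quadForm_single_sub hG.isHermitian (x₀ := x₀) (x₁ := x₁) z₀ z₁ 1 1
  have h1 := quadForm_single_sub hG.isHermitian (x₀ := x₀) (x₁ := x₁) z₀ z₁ δ 1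
  have h2 := quadForm_single_sub hG.isHermitian (x₀ := x₀) (x₁ := x₁) z₀ z₁ 1 δ
  have n1 := quadForm_nonneg hG (Pi.single x₀ ((δ : ℝ) * z₀) - Pi.single x₁ ((1 : ℝ) * z₁))
  have n2 := quadForm_nonneg hG (Pi.single x₀ ((1 : ℝ) * z₀) - Pi.single x₁ ((δ : ℝ) * z₁))
  rw [h1] at n1
  rw [h2] at n2
  simp only [Complex.ofReal_one, one_mul] at h11
  set κ := (star z₀ * G x₀ x₁ * z₁).re
  have hk : k = (1 - δ)⁻¹ * (a₀ + a₁ - 2 * κ) := by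
    simp only [k, h11, a₀, a₁]; ring
  have hδ' : 0 < 1 - δ := by linarith
  rw [hk]
  change 0 ≤ δ ^ 2 * a₀ + 1 ^ 2 * a₁ - 2 * (δ * 1 * κ) at n1
  change 0 ≤ 1 ^ 2 * a₀ + δ ^ 2 * a₁ - 2 * (1 * δ * κ) at n2
  constructor
  · rw [← sub_nonneg]
    have : (1 - δ)⁻¹ * (a₀ + a₁ - 2 * κ) - (a₀ - δ⁻¹ * a₁) =
        (1 - δ)⁻¹ * δ⁻¹ * (δ ^ 2 * a₀ + 1 ^ 2 * a₁ - 2 * (δ * 1 * κ)) := by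
      field_simp
      ring
    rw [this]
    positivity
  · rw [← sub_nonneg]
    have : (1 - δ)⁻¹ * (a₀ + a₁ - 2 * κ) - (a₁ - δ⁻¹ * a₀) =
        (1 - δ)⁻¹ * δ⁻¹ * (1 ^ 2 * a₀ + δ ^ 2 * a₁ - 2 * (1 * δ * κ)) := by
      field_simp
      ring
    rw [this]
    positivity

variable [Fintype Y]

/-- The vector at which the quadratic form of Alice's reduced state bounds Bob's local information;
`ω` is a relative phase. -/
def witness (q : X → ℝ) (x₀ x₁ : X) (ω : ℂ) : X → ℂ :=
  Pi.single x₀ ((√(q x₀) : ℝ) : ℂ)⁻¹ - Pi.single x₁ (((√(q x₁) : ℝ) : ℂ)⁻¹ * ω)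

/-- The weights normalize each diagonal term to 1, and ω rotates the cross term onto the modulus of
the overlap. -/
theorem exists_quadForm_witness (P : X × Y → ℝ) (ψ : EuclideanSpace ℂ (X × Y))
    (hψ : IsRegularEmbedding P ψ) {x₀ x₁ : X} (h₀ : 0 < ∑ y, P (x₀, y))
    (h₁ : 0 < ∑ y, P (x₁, y)) :
    ∃ ω : ℂ, ‖ω‖ = 1 ∧ quadForm (witness (fun x => ∑ y, P (x, y)) x₀ x₁ ω)
      (honestReduced (initialState ψ)) =
        2 - 2 * ‖inner ℂ (condState P ψ x₀) (condState P ψ x₁)‖ := by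
  obtain ⟨ω, hω, hω'⟩ :=
    exists_norm_eq_one_mul_eq_norm (inner ℂ (condState P ψ x₁) (condState P ψ x₀))
  refine ⟨ω, hω, ?_⟩
  have hG := (honestReduced_posSemidef (initialState_posSemidef ψ)).isHermitian
  have h := quadForm_single_sub hG (x₀ := x₀) (x₁ := x₁) (((√(∑ y, P (x₀, y)) : ℝ) : ℂ)⁻¹)
    (((√(∑ y, P (x₁, y)) : ℝ) : ℂ)⁻¹ * ω) 1 1
  simp only [Complex.ofReal_one, one_mul] at h
  rw [witness, h, honestReduced_initialState_apply_self P ψ hψ,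
    honestReduced_initialState_apply_self P ψ hψ]
  have hκ : star (((√(∑ y, P (x₀, y)) : ℝ) : ℂ)⁻¹) * honestReduced (initialState ψ) x₀ x₁ *
      (((√(∑ y, P (x₁, y)) : ℝ) : ℂ)⁻¹ * ω) =
      ‖inner ℂ (condState P ψ x₀) (condState P ψ x₁)‖ := by
    rw [norm_inner_symm, ← hω', inner_condState, honestReduced_apply]
    simp only [initialState, star_inv₀, Complex.star_def, Complex.conj_ofReal]
    have : ∀ y, ψ (x₀, y) * (starRingEnd ℂ) (ψ (x₁, y)) = (starRingEnd ℂ) (ψ (x₁, y)) * ψ (x₀, y) :=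
      fun y => mul_comm _ _
    simp only [this]
    ring
  rw [hκ, norm_mul, hω, mul_one, norm_inv, norm_inv, Complex.norm_real, Complex.norm_real,
    Real.norm_eq_abs, Real.norm_eq_abs, inv_pow, inv_pow, sq_abs, sq_abs, Real.sq_sqrt h₀.le,
    Real.sq_sqrt h₁.le, inv_mul_cancel₀ h₀.ne', inv_mul_cancel₀ h₁.ne', Complex.ofReal_re]
  ring

/-- The expected payoff of a simulator for a fixed announcement `(i, j)`, for the averaged
announcement probabilities. -/
theorem simulator_payoff_le [DecidableEq Y] {m : ℕ} (F : unitInterval → Instrument Y) {q : X → ℝ}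
    {x₀ x₁ : X} (hne : x₀ ≠ x₁) (h₀ : 0 < q x₀) (h₁ : 0 < q x₁) {ω : ℂ} (hω : ‖ω‖ = 1) {δ : ℝ}
    (hδ : 0 < δ) (hδ1 : δ < 1) {i j : Fin m} (hij : i ≠ j) (S : Simulator m (Option Bool))
    (σ : Fin m → Matrix (X × Y) (X × Y) ℂ) (hσ : ∀ k, (σ k).PosSemidef) :
    ∑ x, ∑ b, S.prob F σ x b *
      ((if (x i = x₀ ∨ x i = x₁) ∧ (x j = x₀ ∨ x j = x₁) then 1 / (q (x i) * q (x j)) else 0) *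
        score (2 * δ⁻¹) (decide (x i = x j)) b) ≤
      ((1 - δ)⁻¹) ^ 2 * ∏ k, (if k = i ∨ k = j then quadForm (witness q x₀ x₁ ω) else reTrace)
        (honestReduced (σ k)) := by
  refine S.sum_prob_mul_le F (fun x b =>
    ((if (x i = x₀ ∨ x i = x₁) ∧ (x j = x₀ ∨ x j = x₁) then 1 / (q (x i) * q (x j)) else 0) *
        score (2 * δ⁻¹) (decide (x i = x j)) b)) (((1 - δ)⁻¹) ^ 2)
    (fun k => if k = i ∨ k = j then quadForm (witness q x₀ x₁ ω) else reTrace) ?_ σ hσ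
  intro σ hσ b
  have hG : ∀ k, (honestReduced (σ k)).PosSemidef := fun k => honestReduced_posSemidef (hσ k)
  have hd : ∀ k x, 0 ≤ (honestReduced (σ k) x x).re := fun k x =>
    (Complex.le_def.1 ((hG k).diag_nonneg (i := x))).1
  rw [sum_prod_mul_pair hij (fun k a => (honestReduced (σ k) a a).re) (fun a b' =>
    ((if (a = x₀ ∨ a = x₁) ∧ (b' = x₀ ∨ b' = x₁) then 1 / (q a * q b') else 0) *
        score (2 * δ⁻¹) (decide (a = b')) b)), prod_eq_mul_mul_prod_erase hij, ← mul_assoc]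
  -- Summing over the outcomes of a register that is not announced gives the trace, hence `reTrace`
  -- there.
  have hrest : ∀ k : {k // k ≠ i ∧ k ≠ j},
      (if (k : Fin m) = i ∨ (k : Fin m) = j then quadForm (witness q x₀ x₁ ω) else reTrace)
        (honestReduced (σ k)) = ∑ a, (honestReduced (σ k) a a).re := by
    intro k
    rw [if_neg (by rintro (h | h); exacts [k.2.1 h, k.2.2 h])]
    rfl
  simp only [hrest]
  refine mul_le_mul_of_nonneg_right ?_
    (Finset.prod_nonneg fun k _ => Finset.sum_nonneg fun a _ => hd _ _)
  simp only [true_or, or_true, if_true]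
  have hn₀ : ‖((√(q x₀) : ℝ) : ℂ)⁻¹‖ ^ 2 = (q x₀)⁻¹ := by
    rw [norm_inv, Complex.norm_real, Real.norm_eq_abs, inv_pow, sq_abs, Real.sq_sqrt h₀.le]
  have hn₁ : ‖((√(q x₁) : ℝ) : ℂ)⁻¹ * ω‖ ^ 2 = (q x₁)⁻¹ := by
    rw [norm_mul, hω, mul_one, norm_inv, Complex.norm_real, Real.norm_eq_abs, inv_pow, sq_abs,
      Real.sq_sqrt h₁.le]
  have hki := le_quadForm (hG i) (x₀ := x₀) (x₁ := x₁) ((√(q x₀) : ℝ) : ℂ)⁻¹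
    (((√(q x₁) : ℝ) : ℂ)⁻¹ * ω) hδ hδ1
  have hkj := le_quadForm (hG j) (x₀ := x₀) (x₁ := x₁) ((√(q x₀) : ℝ) : ℂ)⁻¹
    (((√(q x₁) : ℝ) : ℂ)⁻¹ * ω) hδ hδ1
  simp only [hn₀, hn₁] at hki hkj
  have hδ' : 0 < (1 - δ)⁻¹ := inv_pos.2 (by linarith)
  have nki : 0 ≤ (1 - δ)⁻¹ * quadForm (witness q x₀ x₁ ω) (honestReduced (σ i)) :=
    mul_nonneg hδ'.le (quadForm_nonneg (hG i) _)
  have nkj : 0 ≤ (1 - δ)⁻¹ * quadForm (witness q x₀ x₁ ω) (honestReduced (σ j)) :=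
    mul_nonneg hδ'.le (quadForm_nonneg (hG j) _)
  have hsum : ∀ f : X → X → ℝ, ∑ a, ∑ b', f a b' *
      (if (a = x₀ ∨ a = x₁) ∧ (b' = x₀ ∨ b' = x₁) then 1 else 0) =
        f x₀ x₀ + f x₀ x₁ + (f x₁ x₀ + f x₁ x₁) := by
    intro f
    have : ∀ a b', f a b' * (if (a = x₀ ∨ a = x₁) ∧ (b' = x₀ ∨ b' = x₁) then 1 else 0) =
        if a ∈ ({x₀, x₁} : Finset X) then (if b' ∈ ({x₀, x₁} : Finset X) then f a b' else 0)
          else 0 := by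
      intro a b'
      by_cases h1 : a = x₀ ∨ a = x₁ <;> by_cases h2 : b' = x₀ ∨ b' = x₁ <;> simp [h1, h2]
    simp only [this, Finset.sum_ite_irrel, Finset.sum_const_zero, Finset.sum_ite_mem,
      Finset.univ_inter, Finset.sum_pair hne]
  have hf : ∀ a b', (honestReduced (σ i) a a).re * (honestReduced (σ j) b' b').re *
      ((if (a = x₀ ∨ a = x₁) ∧ (b' = x₀ ∨ b' = x₁) then 1 / (q a * q b') else 0) *
        score (2 * δ⁻¹) (decide (a = b')) b) =
      (((q a)⁻¹ * (honestReduced (σ i) a a).re) * ((q b')⁻¹ * (honestReduced (σ j) b' b').re) *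
        score (2 * δ⁻¹) (decide (a = b')) b) *
      (if (a = x₀ ∨ a = x₁) ∧ (b' = x₀ ∨ b' = x₁) then 1 else 0) := by
    intro a b'
    split_ifs
    · rw [one_div, mul_inv]; ring
    · ring
  simp only [hf]
  rw [hsum]
  have ha₀ : 0 ≤ (q x₀)⁻¹ * (honestReduced (σ i) x₀ x₀).re :=
    mul_nonneg (inv_nonneg.2 h₀.le) (hd _ _)
  have ha₁ : 0 ≤ (q x₁)⁻¹ * (honestReduced (σ i) x₁ x₁).re :=
    mul_nonneg (inv_nonneg.2 h₁.le) (hd _ _)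
  have hb₀ : 0 ≤ (q x₀)⁻¹ * (honestReduced (σ j) x₀ x₀).re :=
    mul_nonneg (inv_nonneg.2 h₀.le) (hd _ _)
  have hb₁ : 0 ≤ (q x₁)⁻¹ * (honestReduced (σ j) x₁ x₁).re :=
    mul_nonneg (inv_nonneg.2 h₁.le) (hd _ _)
  have hδ2 : 1 ≤ δ⁻¹ := (one_le_inv₀ hδ).2 hδ1.le
  have hrw : ((1 - δ)⁻¹) ^ 2 * (quadForm (witness q x₀ x₁ ω) (honestReduced (σ i)) *
      quadForm (witness q x₀ x₁ ω) (honestReduced (σ j))) =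
      ((1 - δ)⁻¹ * quadForm (witness q x₀ x₁ ω) (honestReduced (σ i))) *
      ((1 - δ)⁻¹ * quadForm (witness q x₀ x₁ ω) (honestReduced (σ j))) := by ring
  rw [hrw]
  rcases b with _ | b
  · simp only [score, mul_zero, add_zero]
    exact mul_nonneg nki nkj
  -- For the answer "different", the two states exchange roles on the second register.
  · cases b
    · have := separable_payoff_le hδ2 ha₀ ha₁ hb₁ hb₀ nki nkj hki.1 hki.2 hkj.2 hkj.1
      simp only [score, hne, hne.symm, decide_true, decide_false, Bool.false_eq_true, if_true,
        if_false]
      linarith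
    · have := separable_payoff_le hδ2 ha₀ ha₁ hb₀ hb₁ nki nkj hki.1 hki.2 hkj.1 hkj.2
      simp only [score, hne, hne.symm, decide_true, decide_false, Bool.true_eq_false, if_true,
        if_false]
      linarith

end Separable

/-! ### The advantage of the coherent strategy -/

section Advantage

variable {X Y : Type*} [Fintype X] [Fintype Y] [DecidableEq X]

theorem abs_score_le {c : ℝ} (hc : 1 ≤ c) (e : Bool) (b : Option Bool) : |score c e b| ≤ c := by
  rcases b with _ | b
  · simp only [score, abs_zero]
    linarith
  · simp only [score]
    split_ifs
    · simpa using hc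
    · rw [abs_neg, abs_of_nonneg (by linarith)]

variable [DecidableEq Y]

/-- Strategies based on an ideal functionality asymptotically gain at most `((1 - s) / (1 - δ)) ^ 2`,
where `s` is the overlap. -/
theorem challengePayoff_simProb_le (P : X × Y → ℝ) (hP : P ∈ stdSimplex ℝ (X × Y))
    (ψ : EuclideanSpace ℂ (X × Y)) (hψ : IsRegularEmbedding P ψ) {x₀ x₁ : X} (hne : x₀ ≠ x₁)
    (h₀ : 0 < ∑ y, P (x₀, y)) (h₁ : 0 < ∑ y, P (x₁, y)) {δ : ℝ} (hδ : 0 < δ) (hδ1 : δ < 1)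
    {m : ℕ} (hm : 0 < m) (F : unitInterval → Instrument Y)
    (S : Fin m × Fin m → Simulator m (Option Bool)) :
    challengePayoff x₀ x₁ (2 * δ⁻¹) (fun h => simProb F ψ (S h)) ≤
      ((1 - δ)⁻¹ * (1 - ‖inner ℂ (condState P ψ x₀) (condState P ψ x₁)‖)) ^ 2 +
      2 * (2 * δ⁻¹) * ∑ x : Fin m → X, (∏ k, ∑ y, P (x k, y)) *
        totalDeviation (fun x => ∑ y, P (x, y)) x₀ x₁ x := by
  obtain ⟨ω, hω, hquad⟩ := exists_quadForm_witness P ψ hψ h₀ h₁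
  set s := ‖inner ℂ (condState P ψ x₀) (condState P ψ x₁)‖
  set q : X → ℝ := fun x => ∑ y, P (x, y) with hq
  set c : ℝ := 2 * δ⁻¹ with hc
  have hc1 : 1 ≤ c := by
    have : 1 ≤ δ⁻¹ := (one_le_inv₀ hδ).2 hδ1.le
    linarith
  have hm' : (0 : ℝ) < m := by exact_mod_cast hm
  have hq1 : ∑ x, q x = 1 := by
    rw [← hP.2, Fintype.sum_prod_type]
  have hσ : ∀ _ : Fin m, (initialState ψ).PosSemidef := fun _ => initialState_posSemidef ψ
  let A : Fin m × Fin m → (Fin m → X) → ℝ := fun h x =>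
    ∑ b, simProb F ψ (S h) x b * score c (decide (x h.1 = x h.2)) b
  have hA : ∀ h x, |A h x| ≤ c * ∏ k, q (x k) := by
    intro h x
    calc |A h x| ≤ ∑ b, simProb F ψ (S h) x b * c := by
          refine (Finset.abs_sum_le_sum_abs _ _).trans (Finset.sum_le_sum fun b _ => ?_)
          have hn : 0 ≤ simProb F ψ (S h) x b := (S h).prob_nonneg F hσ x b
          rw [abs_mul, abs_of_nonneg hn]
          exact mul_le_mul_of_nonneg_left (abs_score_le hc1 _ _) hn
      _ ≤ (∏ k, q (x k)) * c := by
          rw [← Finset.sum_mul]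
          refine mul_le_mul_of_nonneg_right ?_ (by linarith)
          refine ((S h).sum_prob_le F hσ x).trans (le_of_eq ?_)
          simp only [honestReduced_initialState_apply_self P ψ hψ, hq]
      _ = _ := mul_comm _ _
  -- Each announcement carries 1/(4m²), and the two witnesses give (2 - 2s)²; summed over m²
  -- announcements the factor 4 cancels.
  have hmean : ∀ h : Fin m × Fin m, ∑ x, meanAnnounceProb q x₀ x₁ x h * A h x ≤
      1 / (4 * (m : ℝ) ^ 2) * (((1 - δ)⁻¹) ^ 2 * (2 - 2 * s) ^ 2) := by
    rintro ⟨i, j⟩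
    by_cases hij : i = j
    · simp only [meanAnnounceProb, hij, ne_eq, not_true_eq_false, false_and, if_false, zero_mul,
        Finset.sum_const_zero]
      positivity
    · have hb := simulator_payoff_le F (q := q) hne h₀ h₁ hω hδ hδ1 hij (S (i, j)) _ hσ
      rw [prod_eq_mul_mul_prod_erase hij] at hb
      have hrest : ∀ k : {k // k ≠ i ∧ k ≠ j},
          (if (k : Fin m) = i ∨ (k : Fin m) = j then quadForm (witness q x₀ x₁ ω) else reTrace)
            (honestReduced (initialState ψ)) = 1 := by
        intro k
        rw [if_neg (by rintro (h | h); exacts [k.2.1 h, k.2.2 h]), ← hq1]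
        change ∑ x, (honestReduced (initialState ψ) x x).re = _
        simp only [honestReduced_initialState_apply_self P ψ hψ, hq]
      simp only [hrest, true_or, or_true, if_true, hquad, Finset.prod_const_one, mul_one] at hb
      calc _ = 1 / (4 * (m : ℝ) ^ 2) * ∑ x, ∑ b, (S (i, j)).prob F (fun _ => initialState ψ) x b *
            ((if (x i = x₀ ∨ x i = x₁) ∧ (x j = x₀ ∨ x j = x₁) then 1 / (q (x i) * q (x j))
              else 0) * score c (decide (x i = x j)) b) := by
            rw [Finset.mul_sum]
            refine Finset.sum_congr rfl fun x _ => ?_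
            simp only [A, Finset.mul_sum, simProb]
            refine Finset.sum_congr rfl fun b _ => ?_
            simp only [meanAnnounceProb, hij, ne_eq, not_false_eq_true, true_and]
            split_ifs
            · simp only [one_div, mul_inv]; ring
            · ring
        _ ≤ _ := by
            refine mul_le_mul_of_nonneg_left (hb.trans (le_of_eq ?_)) (by positivity)
            ring
  have hsplit : ∀ x h, announceProb x₀ x₁ x h * A h x ≤ meanAnnounceProb q x₀ x₁ x h * A h x +
      |announceProb x₀ x₁ x h - meanAnnounceProb q x₀ x₁ x h| * (c * ∏ k, q (x k)) := by
    intro x h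
    have h1 : (announceProb x₀ x₁ x h - meanAnnounceProb q x₀ x₁ x h) * A h x ≤
        |announceProb x₀ x₁ x h - meanAnnounceProb q x₀ x₁ x h| * (c * ∏ k, q (x k)) := by
      refine (le_abs_self _).trans ?_
      rw [abs_mul]
      exact mul_le_mul_of_nonneg_left (hA h x) (abs_nonneg _)
    linarith
  calc challengePayoff x₀ x₁ c (fun h => simProb F ψ (S h))
      = ∑ x : Fin m → X, ∑ h, announceProb x₀ x₁ x h * A h x := rfl
    _ ≤ ∑ x : Fin m → X, ∑ h, (meanAnnounceProb q x₀ x₁ x h * A h x +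
          |announceProb x₀ x₁ x h - meanAnnounceProb q x₀ x₁ x h| * (c * ∏ k, q (x k))) :=
        Finset.sum_le_sum fun x _ => Finset.sum_le_sum fun h _ => hsplit x h
    _ = ∑ h, ∑ x : Fin m → X, meanAnnounceProb q x₀ x₁ x h * A h x +
        ∑ x : Fin m → X, (∑ h, |announceProb x₀ x₁ x h - meanAnnounceProb q x₀ x₁ x h|) *
          (c * ∏ k, q (x k)) := by
        simp only [Finset.sum_add_distrib, Finset.sum_mul]
        rw [Finset.sum_comm]
    _ ≤ ∑ _h : Fin m × Fin m, 1 / (4 * (m : ℝ) ^ 2) * (((1 - δ)⁻¹) ^ 2 * (2 - 2 * s) ^ 2) +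
        ∑ x : Fin m → X, (2 * totalDeviation q x₀ x₁ x) * (c * ∏ k, q (x k)) := by
        refine add_le_add (Finset.sum_le_sum fun h _ => hmean h) (Finset.sum_le_sum fun x _ => ?_)
        refine mul_le_mul_of_nonneg_right (sum_abs_announceProb_sub_le hm hne h₀ h₁ x) ?_
        exact mul_nonneg (by linarith) (Finset.prod_nonneg fun k _ =>
          Finset.sum_nonneg fun y _ => hP.1 _)
    _ = _ := by
        rw [Finset.mul_sum]
        congr 1
        · simp only [Finset.sum_const, Finset.card_univ, Fintype.card_prod, Fintype.card_fin,
            nsmul_eq_mul, Nat.cast_mul]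
          field_simp
          ring
        · refine Finset.sum_congr rfl fun x _ => ?_
          ring

/-- The coherent strategy that compares the announced registers. -/
theorem exists_coherent_strategy (P : X × Y → ℝ) (hP : P ∈ stdSimplex ℝ (X × Y))
    (ψ : EuclideanSpace ℂ (X × Y)) (hψ : IsRegularEmbedding P ψ) {x₀ x₁ : X} (hne : x₀ ≠ x₁)
    (h₀ : 0 < ∑ y, P (x₀, y)) (h₁ : 0 < ∑ y, P (x₁, y))
    (hs0 : 0 < ‖inner ℂ (condState P ψ x₀) (condState P ψ x₁)‖)
    (hs1 : ‖inner ℂ (condState P ψ x₀) (condState P ψ x₁)‖ < 1) (c : ℝ) {m : ℕ} (hm : 0 < m) :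
    ∃ E : Fin m × Fin m → POVM (Fin m → Y) (Option Bool),
      (1 - ‖inner ℂ (condState P ψ x₀) (condState P ψ x₁)‖) *
        (1 - 3 * ∑ x : Fin m → X, (∏ k, ∑ y, P (x k, y)) *
          totalDeviation (fun x => ∑ y, P (x, y)) x₀ x₁ x) ≤
      challengePayoff x₀ x₁ c (fun h => attackProb ψ (E h)) := by
  have hex : ∀ h : Fin m × Fin m, ∃ E : POVM (Fin m → Y) (Option Bool), h.1 ≠ h.2 →
      ∀ x : Fin m → X, (x h.1 = x₀ ∨ x h.1 = x₁) → (x h.2 = x₀ ∨ x h.2 = x₁) → ∀ e,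
        attackProb ψ E x (some e) = (if e = decide (x h.1 = x h.2) then
          1 - ‖inner ℂ (condState P ψ x₀) (condState P ψ x₁)‖ else 0) * ∏ k, ∑ y, P (x k, y) := by
    intro h
    by_cases hh : h.1 = h.2
    -- Equal positions are never announced, so any measurement serves; this one always answers
    -- "don't know".
    · refine ⟨⟨fun o => if o = none then 1 else 0, fun o => ?_, by simp⟩, fun h' => absurd hh h'⟩
      split_ifs
      · exact Matrix.PosSemidef.one
      · exact Matrix.PosSemidef.zero
    · obtain ⟨E, hE⟩ := exists_comparison_povm P ψ hψ h₀ h₁ rfl hs0 hs1 hh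
      exact ⟨E, fun _ => hE⟩
  choose E hE using hex
  refine ⟨E, ?_⟩
  set s := ‖inner ℂ (condState P ψ x₀) (condState P ψ x₁)‖
  set q : X → ℝ := fun x => ∑ y, P (x, y) with hq
  have hq1 : ∑ x, q x = 1 := by
    rw [← hP.2, Fintype.sum_prod_type]
  have hterm : ∀ x h, announceProb x₀ x₁ x h *
      ∑ b, attackProb ψ (E h) x b * score c (decide (x h.1 = x h.2)) b =
      announceProb x₀ x₁ x h * ((1 - s) * ∏ k, q (x k)) := by
    intro x h
    by_cases hh : h.1 ≠ h.2 ∧ (x h.1 = x₀ ∨ x h.1 = x₁) ∧ (x h.2 = x₀ ∨ x h.2 = x₁)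
    · congr 1
      rw [Fintype.sum_option, Fintype.sum_bool, hE h hh.1 x hh.2.1 hh.2.2,
        hE h hh.1 x hh.2.1 hh.2.2]
      by_cases he : x h.1 = x h.2 <;> simp [he, score, hq]
    · have : announceProb x₀ x₁ x h = 0 := by
        rw [announceProb, if_neg]
        rintro ⟨-, -, h1⟩
        exact hh h1
      simp [this]
  calc (1 - s) * (1 - 3 * ∑ x : Fin m → X, (∏ k, q (x k)) * totalDeviation q x₀ x₁ x)
      = (1 - s) * (∑ x : Fin m → X, ∏ k, q (x k) -
          3 * ∑ x : Fin m → X, (∏ k, q (x k)) * totalDeviation q x₀ x₁ x) := by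
        rw [sum_prod_eq_one hq1]
    _ = ∑ x : Fin m → X, (1 - 3 * totalDeviation q x₀ x₁ x) * ((1 - s) * ∏ k, q (x k)) := by
        rw [Finset.mul_sum, ← Finset.sum_sub_distrib, Finset.mul_sum]
        refine Finset.sum_congr rfl fun x _ => ?_
        ring
    _ ≤ ∑ x : Fin m → X, (∑ h, announceProb x₀ x₁ x h) * ((1 - s) * ∏ k, q (x k)) := by
        refine Finset.sum_le_sum fun x _ => mul_le_mul_of_nonneg_right
          (le_sum_announceProb hm hne h₀ h₁ x) ?_
        exact mul_nonneg (by linarith) (Finset.prod_nonneg fun k _ =>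
          Finset.sum_nonneg fun y _ => hP.1 _)
    _ = _ := by
        simp only [challengePayoff, hterm, Finset.sum_mul]

/-- If two outcomes leave states that are neither orthogonal nor parallel, then coherent strategies
beat all strategies based on ideal functionalities. -/
theorem exists_advantage (P : X × Y → ℝ) (hP : P ∈ stdSimplex ℝ (X × Y))
    (ψ : EuclideanSpace ℂ (X × Y)) (hψ : IsRegularEmbedding P ψ) {x₀ x₁ : X}
    (h₀ : 0 < ∑ y, P (x₀, y)) (h₁ : 0 < ∑ y, P (x₁, y))
    (hs0 : 0 < ‖inner ℂ (condState P ψ x₀) (condState P ψ x₁)‖)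
    (hs1 : ‖inner ℂ (condState P ψ x₀) (condState P ψ x₁)‖ < 1) :
    ∃ c : ℝ, 0 < c ∧ ∃ ε : ℝ, 0 < ε ∧ ∃ M : ℕ, ∀ m ≥ M,
      ∃ E : Fin m × Fin m → POVM (Fin m → Y) (Option Bool),
        ∀ (I : IdealFunctionality X Y) (S : Fin m × Fin m → Simulator m (Option Bool)),
          challengePayoff x₀ x₁ c (fun h => simProb I.bob ψ (S h)) + ε ≤
            challengePayoff x₀ x₁ c (fun h => attackProb ψ (E h)) := by
  have hne : x₀ ≠ x₁ := by
    rintro rfl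
    rw [inner_self_eq_norm_sq_to_K, norm_condState P ψ hψ h₀] at hs1
    simp at hs1
  set s := ‖inner ℂ (condState P ψ x₀) (condState P ψ x₁)‖ with hs
  set q : X → ℝ := fun x => ∑ y, P (x, y) with hq
  have hq0 : ∀ x, 0 ≤ q x := fun x => Finset.sum_nonneg fun y _ => hP.1 _
  have hq1 : ∑ x, q x = 1 := by
    rw [← hP.2, Fintype.sum_prod_type]
  -- The choice δ = s/2 satisfies (1 - δ)² > 1 - s, with difference s²/4; this is what makes `gap`
  -- positive.
  have hδ : 0 < s / 2 := by linarith
  have hδ1 : s / 2 < 1 := by linarith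
  set c : ℝ := 2 * (s / 2)⁻¹ with hc
  have hc0 : 0 < c := by positivity
  set K : ℝ := ∑ α ∈ {x₀, x₁}, ∑ β ∈ {x₀, x₁}, 3 / (q α * q β) with hK
  have hK0 : 0 ≤ K := Finset.sum_nonneg fun α _ => Finset.sum_nonneg fun β _ =>
    div_nonneg (by norm_num) (mul_nonneg (hq0 _) (hq0 _))
  set gap : ℝ := (1 - s) - ((1 - s / 2)⁻¹ * (1 - s)) ^ 2 with hgap
  have hgap0 : 0 < gap := by
    have h2 : 0 < 1 - s / 2 := by linarith
    have : gap = (1 - s) * (s ^ 2 / 4) / (1 - s / 2) ^ 2 := by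
      rw [hgap, mul_pow, inv_pow, eq_div_iff (pow_ne_zero 2 h2.ne'), sub_mul, mul_right_comm,
        inv_mul_cancel₀ (pow_ne_zero 2 h2.ne')]
      ring
    rw [this]
    have : 0 < 1 - s := by linarith
    positivity
  -- The fluctuations cost 2c·D in the simulation bound and at most 3·D in the coherent one; for
  -- large m both fit into half of the gap.
  obtain ⟨M, hM⟩ := exists_nat_gt (((2 * c + 3) * K / (gap / 2)) ^ 2)
  refine ⟨c, hc0, gap / 2, by linarith, M + 1, fun m hm => ?_⟩
  have hm0 : 0 < m := by omega
  have hm' : (0 : ℝ) < m := by exact_mod_cast hm0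
  obtain ⟨E, hE⟩ := exists_coherent_strategy P hP ψ hψ hne h₀ h₁ hs0 hs1 c hm0
  refine ⟨E, fun I S => ?_⟩
  have hS := challengePayoff_simProb_le P hP ψ hψ hne h₀ h₁ hδ hδ1 hm0 I.bob S
  have hD := sum_totalDeviation_le hm0 hq0 hq1 h₀ h₁
  rw [← hs, ← hc] at hS
  rw [← hs] at hE
  set D : ℝ := ∑ x : Fin m → X, (∏ k, q (x k)) * totalDeviation q x₀ x₁ x with hDdef
  have hD0 : 0 ≤ D := Finset.sum_nonneg fun x _ => mul_nonneg
    (Finset.prod_nonneg fun k _ => hq0 _)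
    (Finset.sum_nonneg fun α _ => Finset.sum_nonneg fun β _ => abs_nonneg _)
  have hsm : 0 < √(m : ℝ) := Real.sqrt_pos.2 hm'
  have hbig : (2 * c + 3) * K / (gap / 2) ≤ √(m : ℝ) := by
    refine Real.le_sqrt_of_sq_le (hM.le.trans ?_)
    exact_mod_cast (by omega : M ≤ m)
  have hsmall : (2 * c + 3) * D ≤ gap / 2 := by
    calc (2 * c + 3) * D ≤ (2 * c + 3) * (K / √m) := by gcongr
      _ ≤ gap / 2 := by
        rw [← mul_div_assoc, div_le_iff₀ hsm]
        rw [div_le_iff₀ (by linarith)] at hbig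
        linarith
  have h3 : (1 - s) * (3 * D) ≤ 3 * D := mul_le_of_le_one_left (by linarith) (by linarith)
  linarith

end Advantage

end Composability

end

/-- Positivity of P_X at x₀ and x₁ is implicit in the nonzero overlap: where the marginal vanishes,
`condState` is 0, because the inverse of 0 is 0. -/
theorem mainTheorem2 {X Y : Type*} [Fintype X] [Fintype Y] [DecidableEq X] [DecidableEq Y]
    (P : X × Y → ℝ) (hP : P ∈ stdSimplex ℝ (X × Y))
    (ψ : EuclideanSpace ℂ (X × Y)) (hψ : Composability.IsRegularEmbedding P ψ) :
    (Composability.WeaklySelfComposable ψ → Composability.IsTrivial P ψ) ∧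
    (¬ Composability.IsTrivial P ψ →
      ∃ x₀ x₁ : X,
        0 < ‖inner ℂ (Composability.condState P ψ x₀) (Composability.condState P ψ x₁)‖ ∧
        ‖inner ℂ (Composability.condState P ψ x₀) (Composability.condState P ψ x₁)‖ < 1 ∧
        ∃ c : ℝ, 0 < c ∧ ∃ ε : ℝ, 0 < ε ∧ ∃ M : ℕ, ∀ m ≥ M,
          ∃ E : Fin m × Fin m → Composability.POVM (Fin m → Y) (Option Bool),
            ∀ (I : Composability.IdealFunctionality X Y)
              (S : Fin m × Fin m → Composability.Simulator m (Option Bool)),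
              Composability.challengePayoff x₀ x₁ c
                  (fun h => Composability.simProb I.bob ψ (S h)) + ε ≤
                Composability.challengePayoff x₀ x₁ c
                  (fun h => Composability.attackProb ψ (E h))) := by
  have hpart2 : ¬ Composability.IsTrivial P ψ →
      ∃ x₀ x₁ : X,
        0 < ‖inner ℂ (Composability.condState P ψ x₀) (Composability.condState P ψ x₁)‖ ∧
        ‖inner ℂ (Composability.condState P ψ x₀) (Composability.condState P ψ x₁)‖ < 1 ∧
        ∃ c : ℝ, 0 < c ∧ ∃ ε : ℝ, 0 < ε ∧ ∃ M : ℕ, ∀ m ≥ M,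
          ∃ E : Fin m × Fin m → Composability.POVM (Fin m → Y) (Option Bool),
            ∀ (I : Composability.IdealFunctionality X Y)
              (S : Fin m × Fin m → Composability.Simulator m (Option Bool)),
              Composability.challengePayoff x₀ x₁ c
                  (fun h => Composability.simProb I.bob ψ (S h)) + ε ≤
                Composability.challengePayoff x₀ x₁ c
                  (fun h => Composability.attackProb ψ (E h)) := by
    intro hnt
    obtain ⟨x₀, x₁, h₀, h₁, hs0, hs1⟩ :=
      Composability.exists_overlap_of_depEntropy_ne_zero P ψ hψ (not_or.1 hnt).2
    exact ⟨x₀, x₁, hs0, hs1, Composability.exists_advantage P hP ψ hψ h₀ h₁ hs0 hs1⟩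
  refine ⟨fun ⟨I, hI, _⟩ => ?_, hpart2⟩
  by_contra hnt
  obtain ⟨x₀, x₁, -, -, c, -, ε, hε, M, hM⟩ := hpart2 hnt
  obtain ⟨E, hE⟩ := hM (M + 1) (Nat.le_succ M)
  -- The attack for each announcement is simulated separately, which yields a strategy with exactly
  -- the coherent payoff.
  choose S hS using fun h => hI (M + 1) M.succ_pos (Option Bool) (E h)
  have := hE I S
  have heq : (fun h => Composability.simProb I.bob ψ (S h)) =
      fun h => Composability.attackProb ψ (E h) :=
    funext fun h => funext fun x => funext fun o => hS h x o
  rw [heq] at this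
  linarith
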